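/- **Notation.** For real $a,b,p,q,r$ say that $(a,b,p,q,r)\in P$ if $r\notin\{0,-1,-2,\dots\}$, ${}_2F_1(p,q;r;x)>0$ for all $x\in(0,1)$, and $a,\ b,\ r+b-p-q>0$; then $BH(a,b,p,q,r)$ is the probability distribution on $(0,1)$ with density proportional to $x^{a-1}(1-x)^{b-1}{}_2F_1(p,q;r;x)$. For $\theta=(\theta_1,\dots,\theta_5)\in\mathbb R^5$ put $BH_\theta=BH(a,b,p,q,r)$ with $$a=\theta_4+\theta_5,\quad b=\theta_1+\theta_3,\quad p=\theta_3+\theta_5,\quad q=\theta_3+\theta_4,\quad r=\theta_2+\theta_3+\theta_4+\theta_5,$$ and say that $BH_\theta$ exists if $(a,b,p,q,r)\in P$. Existence of $BH_\theta$ and $BH_\theta$ itself depend only on $v_\theta=(\theta_1,\{\theta_2,\theta_3\},\{\theta_4,\theta_5\})$ (the braces denote multisets), so one writes $BH_{v}$ for $v=v_\theta$. For $c,d>0$, $\beta^{(2)}_{c,d}$ is the beta prime distribution on $(0,\infty)$ with density $\frac{1}{B(c,d)}\,w^{c-1}(1+w)^{-c-d}$. From each $v=(\theta_1,\{\theta_2,\theta_3\},\{\theta_4,\theta_5\})$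 there are arrows to $(\theta_5,\{\theta_1,\theta_4\},\{\theta_2,\theta_3\})$ and to $(\theta_4,\{\theta_1,\theta_5\},\{\theta_2,\theta_3\})$. With an arrow $v\to v'$ one associates the parameters $(c,d)=(\theta_1+\theta_5,\theta_2+\theta_3)$ in the first case and $(c,d)=(\theta_1+\theta_4,\theta_2+\theta_3)$ in the second, and, if $c,d>0$, the law $\beta^{(v,v')}=\beta^{(2)}_{c,d}$. The directed graph $G_\theta$ consists of all vertices that can be reached from $v_\theta$ and of the arrows between them; $G^{**}_\theta$ is obtained from it by removing the arrows for which $c>0,\ d>0$ fails, the vertices $v$ for which $BH_v$ does not exist, and the arrows adjacent to these vertices. A cycle of order $k\ge1$ is a sequence $v_0\to v_1\to\dots\to v_{k-1}\to v_0$ of arrows with $v_0,\dots,v_{k-1}$ distinct. **Theorem.** Let $\theta\in\mathbb R^5$ and let $v_0\to v_1\to\dots\to v_{k-1}\to v_0$ be a cycle of order $k$ in $G^{**}_\theta$, with indices extended to all of $\mathbb N$ modulo $k$. Let $W_1,W_2,\dots$ be independent positive random variables with $W_j\sim\beta^{(v_{j-1},v_j)}$. Put $H_w(x)=\frac1{1+wx}$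 and $$G_n=H_{W_{nk}}\circ H_{W_{nk-1}}\circ\dots\circ H_{W_{(n-1)k+1}},\qquad n\ge1,$$ and for $x\in(0,1)$ let $X_0(x)=x$ and $X_n(x)=G_n(X_{n-1}(x))$. Then, for every $x\in(0,1)$, $(X_n(x))_{n\ge0}$ is a homogeneous Markov chain on $(0,1)$, with transition kernel sending $y$ to the law of $G_1(y)$. This chain has exactly one stationary distribution (probability measure on $(0,1)$ invariant under the transition kernel), and it is $BH_{v_0}$. -/

import Mathlib

open MeasureTheory ProbabilityTheory Set

/-! ## Beta-hypergeometric distributions with traditional parameters -/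

/-- The unnormalised density `x ^ (a - 1) * (1 - x) ^ (b - 1) * ₂F₁(p, q; r; x)` for `0 < x < 1`. -/
noncomputable def bhFun (a b p q r x : ℝ) : ℝ :=
  x ^ (a - 1) * (1 - x) ^ (b - 1) * ordinaryHypergeometric p q r x

/-- The set `P` of parameters `(a, b, p, q, r)` for which `BH(a, b, p, q, r)` is defined:
`r` is not a nonpositive integer, `₂F₁(p, q; r; ·)` is positive on `(0, 1)`, and
`a, b, r + b - p - q > 0`. -/
def BHAdmissible (a b p q r : ℝ) : Prop :=
  (∀ n : ℕ, r ≠ -(n : ℝ)) ∧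
  (∀ x ∈ Ioo (0 : ℝ) 1, 0 < ordinaryHypergeometric p q r x) ∧
  0 < a ∧ 0 < b ∧ 0 < r + b - p - q

/-- The measure `BH(a, b, p, q, r)` on the line: it is carried by `(0, 1)`, where its density is
`bhFun a b p q r` divided by the total integral. -/
noncomputable def bhMeasure (a b p q r : ℝ) : Measure ℝ :=
  (volume.restrict (Ioo (0 : ℝ) 1)).withDensity fun x =>
    ENNReal.ofReal (bhFun a b p q r x / ∫ y in Ioo (0 : ℝ) 1, bhFun a b p q r y)

/-- The beta distribution of the second kind (beta prime distribution) with parameters `c, d > 0`: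
density `w ^ (c - 1) / (B(c, d) * (1 + w) ^ (c + d))` on `(0, ∞)`. -/
noncomputable def betaPrime (c d : ℝ) : Measure ℝ :=
  (volume.restrict (Ioi (0 : ℝ))).withDensity fun w =>
    ENNReal.ofReal (1 / ProbabilityTheory.beta c d * (w ^ (c - 1) / (1 + w) ^ (c + d)))

/-! ## The symmetric parametrisation -/

/-- A point `(θ₁, θ₂, θ₃, θ₄, θ₅)` of `ℝ⁵`. -/
@[ext]
structure Theta where
  θ₁ : ℝ
  θ₂ : ℝ
  θ₃ : ℝ
  θ₄ : ℝ
  θ₅ : ℝ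

namespace Theta

/-- The parameter `a`. -/
def a (t : Theta) : ℝ := t.θ₄ + t.θ₅

/-- The parameter `b`. -/
def b (t : Theta) : ℝ := t.θ₁ + t.θ₃

/-- The parameter `p`. -/
def p (t : Theta) : ℝ := t.θ₃ + t.θ₅

/-- The parameter `q`. -/
def q (t : Theta) : ℝ := t.θ₃ + t.θ₄

/-- The parameter `r`. -/
def r (t : Theta) : ℝ := t.θ₂ + t.θ₃ + t.θ₄ + t.θ₅

/-- The defining equations of `a, b, p, q, r` are the inverse of the linear map
`2θ₁ = a + 2b - p - q`, `2θ₂ = -a - p - q + 2r`, `2θ₃ = -a + p + q`, `2θ₄ = a - p + q`,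
`2θ₅ = a + p - q`. -/
theorem two_mul_eq (t : Theta) :
    2 * t.θ₁ = t.a + 2 * t.b - t.p - t.q ∧ 2 * t.θ₂ = -t.a - t.p - t.q + 2 * t.r ∧
    2 * t.θ₃ = -t.a + t.p + t.q ∧ 2 * t.θ₄ = t.a - t.p + t.q ∧ 2 * t.θ₅ = t.a + t.p - t.q := by
  refine ⟨?_, ?_, ?_, ?_, ?_⟩ <;> simp only [a, b, p, q, r] <;> ring

/-- The distribution `BH_θ = BH(a, b, p, q, r)`. -/
noncomputable def bh (t : Theta) : Measure ℝ := bhMeasure t.a t.b t.p t.q t.r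

/-- `BH_θ` exists, that is `(a, b, p, q, r) ∈ P`. -/
def BHExists (t : Theta) : Prop := BHAdmissible t.a t.b t.p t.q t.r

end Theta

/-- The quotient of `ℝ⁵` whose points are `(θ₁, {θ₂, θ₃}, {θ₄, θ₅})`, where the braces denote
two-element multisets. -/
abbrev BHVertex : Type := ℝ × Sym2 ℝ × Sym2 ℝ

/-- `v_θ = (θ₁, {θ₂, θ₃}, {θ₄, θ₅})`. -/
def Theta.vertex (t : Theta) : BHVertex := (t.θ₁, s(t.θ₂, t.θ₃), s(t.θ₄, t.θ₅))

/-! ## The graphs -/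

/-- The arrows: `(θ₁, {θ₂, θ₃}, {θ₄, θ₅})` leads to `(θ₅, {θ₁, θ₄}, {θ₂, θ₃})` and to
`(θ₄, {θ₁, θ₅}, {θ₂, θ₃})`. -/
inductive BHArrow : BHVertex → BHVertex → Prop
  | fst (t : Theta) : BHArrow t.vertex (Theta.mk t.θ₅ t.θ₁ t.θ₄ t.θ₂ t.θ₃).vertex
  | snd (t : Theta) : BHArrow t.vertex (Theta.mk t.θ₄ t.θ₁ t.θ₅ t.θ₂ t.θ₃).vertex

/-- The vertex set of `G_θ`: everything that can be reached from `v_θ` along arrows. -/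
def graphVertices (t : Theta) : Set BHVertex := {v | Relation.ReflTransGen BHArrow t.vertex v}

/-- First parameter of the beta prime law attached to the arrow from `v` to `v'`. It is
`θ₁ + θ₅` if `v' = (θ₅, {θ₁, θ₄}, {θ₂, θ₃})` and `θ₁ + θ₄` if `v' = (θ₄, {θ₁, θ₅}, {θ₂, θ₃})`. -/
def arrowParam₁ (v v' : BHVertex) : ℝ := v.1 + v'.1

/-- Second parameter of the beta prime law attached to an arrow starting from `v`:
the sum `θ₂ + θ₃`. -/
def arrowParam₂ (v : BHVertex) : ℝ := Sym2.lift ⟨fun x y => x + y, add_comm⟩ v.2.1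

/-- The law `β^{(v, v')}` attached to an arrow. -/
noncomputable def arrowLaw (v v' : BHVertex) : Measure ℝ :=
  betaPrime (arrowParam₁ v v') (arrowParam₂ v)

/-- The edges of `G_θ`. -/
def EdgeG (t : Theta) (v v' : BHVertex) : Prop :=
  v ∈ graphVertices t ∧ v' ∈ graphVertices t ∧ BHArrow v v'

/-- The edges of `G*_θ`: the acceptable edges of `G_θ`, for which both parameters of the beta prime
law are positive. -/
def EdgeGStar (t : Theta) (v v' : BHVertex) : Prop :=
  EdgeG t v v' ∧ 0 < arrowParam₁ v v' ∧ 0 < arrowParam₂ v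

/-- `BH_v` exists. -/
def BHVertex.BHExists (v : BHVertex) : Prop := ∃ s : Theta, s.vertex = v ∧ s.BHExists

/-- The edges of `G**_θ`: the edges of `G*_θ` that remain after erasing the vertices `v` for which
`BH_v` does not exist. -/
def EdgeGStarStar (t : Theta) (v v' : BHVertex) : Prop :=
  EdgeGStar t v v' ∧ BHVertex.BHExists v ∧ BHVertex.BHExists v'

/-- `v₀ → v₁ → ⋯ → v_{k-1} → v₀` is a cycle of order `k ≥ 1` in `G**_θ`; the vertices
`v₀, …, v_{k-1}` are distinct, and `v` is extended to all indices modulo `k`. -/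
structure IsCycleGStarStar (t : Theta) (k : ℕ) (v : ℕ → BHVertex) : Prop where
  pos : 0 < k
  periodic : ∀ j, v (j + k) = v j
  distinct : InjOn v (Iio k)
  edge : ∀ j, EdgeGStarStar t (v j) (v (j + 1))

/-! ## The random Moebius maps and the Markov chain -/

/-- The open interval `(0, 1)` as a type. -/
abbrev OpenUnit : Type := Ioo (0 : ℝ) 1

/-- The Moebius map `H_w(x) = 1 / (1 + w x)` of `(0, 1)` into itself, for `w > 0`. -/
noncomputable def moebiusH (w : Ioi (0 : ℝ)) (x : OpenUnit) : OpenUnit :=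
  ⟨1 / (1 + (w : ℝ) * (x : ℝ)), by
    have hwx : 0 < (w : ℝ) * (x : ℝ) := mul_pos w.2 x.2.1
    refine ⟨by positivity, ?_⟩
    rw [div_lt_one (by positivity)]
    linarith⟩

/-- `moebiusBlock w s m = H_{w (s + m - 1)} ∘ ⋯ ∘ H_{w (s + 1)} ∘ H_{w s}` (`m` factors). -/
noncomputable def moebiusBlock (w : ℕ → Ioi (0 : ℝ)) (s : ℕ) : ℕ → OpenUnit → OpenUnit
  | 0, x => x
  | m + 1, x => moebiusH (w (s + m)) (moebiusBlock w s m x)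

/-- The chain started at `x`: the `(n + 1)`-st step applies the block of the `k` maps with indices
`n * k, …, n * k + k - 1`. -/
noncomputable def moebiusChain (w : ℕ → Ioi (0 : ℝ)) (k : ℕ) (x : OpenUnit) : ℕ → OpenUnit
  | 0 => x
  | n + 1 => moebiusBlock w (n * k) k (moebiusChain w k x n)

theorem measurable_moebiusH : Measurable fun z : Ioi (0 : ℝ) × OpenUnit => moebiusH z.1 z.2 := by
  unfold moebiusH
  refine Measurable.subtype_mk ?_
  fun_prop

theorem measurable_moebiusBlock (s m : ℕ) :
    Measurable fun z : (ℕ → Ioi (0 : ℝ)) × OpenUnit => moebiusBlock z.1 s m z.2 := by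
  induction m with
  | zero => exact measurable_snd
  | succ m ih =>
    exact measurable_moebiusH.comp
      (((measurable_pi_apply (s + m)).comp measurable_fst).prodMk ih)

theorem measurable_moebiusChain (k n : ℕ) :
    Measurable fun z : (ℕ → Ioi (0 : ℝ)) × OpenUnit => moebiusChain z.1 k z.2 n := by
  induction n with
  | zero => exact measurable_snd
  | succ n ih => exact (measurable_moebiusBlock (n * k) k).comp (measurable_fst.prodMk ih)

/-- The one-step transition kernel of the chain: `x` is sent to the law of `X₁(x)`. -/
noncomputable def chainKernel {Ω : Type*} [MeasurableSpace Ω] (P : Measure Ω) [SFinite P]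
    (W : ℕ → Ω → Ioi (0 : ℝ)) (hW : ∀ j, Measurable (W j)) (k : ℕ) :
    Kernel OpenUnit OpenUnit where
  toFun x := P.map fun ω => moebiusChain (fun j => W j ω) k x 1
  measurable' := by
    have hf : Measurable fun z : OpenUnit × Ω => moebiusChain (fun j => W j z.2) k z.1 1 :=
      (measurable_moebiusChain k 1).comp
        ((measurable_pi_lambda _ fun j => (hW j).comp measurable_snd).prodMk measurable_fst)
    refine Measure.measurable_of_measurable_coe _ fun B hB => ?_
    have h : ∀ x : OpenUnit, (P.map fun ω => moebiusChain (fun j => W j ω) k x 1) B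
        = P (Prod.mk x ⁻¹'
            ((fun z : OpenUnit × Ω => moebiusChain (fun j => W j z.2) k z.1 1) ⁻¹' B)) :=
      fun x => Measure.map_apply (hf.comp measurable_prodMk_left) hB
    simp only [h]
    exact measurable_measure_prodMk_left (hf hB)

/-- `X` is a homogeneous Markov chain with transition kernel `κ`: conditionally on
`X₀, …, X_n`, the law of `X_{n+1}` is `κ (X_n)`. -/
def IsMarkovChainWith {Ω S : Type*} [MeasurableSpace Ω] [MeasurableSpace S] (P : Measure Ω)
    (κ : Kernel S S) (X : ℕ → Ω → S) : Prop :=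
  (∀ n, Measurable (X n)) ∧
  ∀ (n : ℕ) (B : Set S), MeasurableSet B →
    P[(X (n + 1) ⁻¹' B).indicator (fun _ => (1 : ℝ)) |
        ⨆ m : Fin (n + 1), MeasurableSpace.comap (X m) inferInstance]
      =ᵐ[P] fun ω => (κ (X n ω)).real B

/-- A stationary distribution of a transition kernel: an invariant probability measure. -/
def IsStationaryDistribution {S : Type*} [MeasurableSpace S] (κ : Kernel S S)
    (μ : Measure S) : Prop :=
  IsProbabilityMeasure μ ∧ κ.Invariant μ

/-! ### Raabe's test for series with hypergeometric term ratios. -/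

section Convergence

open Filter Topology

/-! Everything rests on a one-step identity (`integral_bhFun_mul_rpow`,
`lintegral_bhMeasure_betaPrime`). Let X have law BH(a, b, p, q, r) and let W be an independent beta
prime variable with parameters c = a + b - q and d = r - a. Given X = x, the density of 1/(1 + W x)
at y is proportional to x^d (1-y)^(c-1) y^(d-1) (1 - y(1-x))^(-(c+d)). Here x^d turns x^(a-1) into
x^(r-1), and c + d = r + b - q. Expanding the last factor in powers of y leaves the integrals J(b+n)
of x^(r-1) (1-x)^(b+n-1) ₂F₁(p, q; r; x). Their successive ratios come from the contiguity relation
behind Gauss's theorem (`integral_bhFun_add_one`); the Pochhammer symbols of r + b - q cancel, and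
the series sums to J(b) ₂F₁(b, r+b-p-q; r+b-p; y). So the new law is again beta-hypergeometric, and
in the coordinates θ its parameters are merely permuted.

The law depends only on the vertex: exchanging θ₄ and θ₅ exchanges p and q, while exchanging θ₂ and
θ₃ is Euler's transformation (`Theta.BHExists.of_vertex_eq`). Hence each arrow carries the law of
its source to that of its target (`bind_stepKernel`), and going once round the cycle gives
invariance.

For uniqueness, the last map of a block has a strictly positive density on (0, 1) from every
starting point, so every transition probability charges every set of positive Lebesgue measure. Of
two complementary sets one has positive measure, and a Hahn decomposition argument then excludes two
stationary laws (`IsStationaryDistribution.unique`). The Markov property holds because successive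
steps use disjoint blocks of the independent W's, with laws repeating modulo k. -/

theorem eventually_quadratic_nonneg {δ : ℝ} (hδ : 0 < δ) (c₁ c₀ : ℝ) :
    ∀ᶠ n : ℕ in atTop, 0 ≤ δ * (n : ℝ) ^ 2 + c₁ * n + c₀ := by
  filter_upwards [tendsto_natCast_atTop_atTop.eventually_ge_atTop ((|c₁| + |c₀|) / δ),
    eventually_ge_atTop 1] with n hn h1
  have h1' : (1 : ℝ) ≤ n := by exact_mod_cast h1
  rw [div_le_iff₀ hδ] at hn
  have e1 : -|c₁| ≤ c₁ := neg_abs_le c₁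
  have e0 : -|c₀| ≤ c₀ := neg_abs_le c₀
  nlinarith [abs_nonneg c₀, mul_le_mul_of_nonneg_right hn (by linarith : (0 : ℝ) ≤ n),
    mul_le_mul_of_nonneg_right e1 (by linarith : (0 : ℝ) ≤ n),
    mul_le_mul_of_nonneg_left h1' (abs_nonneg c₀)]

theorem tendsto_natCast_add_atTop (c : ℝ) : Tendsto (fun n : ℕ => c + (n : ℝ)) atTop atTop :=
  tendsto_atTop_add_const_left _ _ tendsto_natCast_atTop_atTop

/-- A form of Raabe's test. -/
theorem raabe_test {u : ℕ → ℝ} {δ : ℝ} (hδ : 0 < δ)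
    (h : ∀ᶠ n : ℕ in atTop, δ * |u n| ≤ n * |u n| - (n + 1) * |u (n + 1)|) :
    Summable (fun n => |u n|) ∧ Tendsto (fun n : ℕ => n * u n) atTop (𝓝 0) := by
  obtain ⟨N, hN⟩ := eventually_atTop.1 h
  set v : ℕ → ℝ := fun n => |u (n + N)| with hv
  set w : ℕ → ℝ := fun n => ((n : ℝ) + N) * |u (n + N)| with hw
  have hstep : ∀ n, δ * v n ≤ w n - w (n + 1) := by
    intro n
    have := hN (n + N) (by omega)
    simp only [hv, hw]
    rw [show n + 1 + N = n + N + 1 by ring]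
    push_cast at this ⊢
    linarith
  have hw0 : ∀ n, 0 ≤ w n := fun n => by positivity
  have hsum : ∀ n, δ * ∑ i ∈ Finset.range n, v i ≤ w 0 - w n := by
    intro n
    induction n with
    | zero => simp
    | succ n ih => rw [Finset.sum_range_succ, mul_add]; linarith [hstep n]
  have hvs : Summable v := by
    refine summable_of_sum_range_le (c := w 0 / δ) (fun n => abs_nonneg _) fun n => ?_
    rw [le_div_iff₀ hδ]
    linarith [hsum n, hw0 n]
  have hanti : Antitone w := antitone_nat_of_succ_le fun n => by
    have : 0 ≤ δ * v n := mul_nonneg hδ.le (abs_nonneg _)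
    linarith [hstep n]
  refine ⟨(summable_nat_add_iff (f := fun n => |u n|) N).1 hvs, ?_⟩
  have hlim := tendsto_atTop_ciInf hanti ⟨0, by rintro _ ⟨n, rfl⟩; exact hw0 n⟩
  set L := ⨅ n, w n
  have hL0 : 0 ≤ L := le_ciInf hw0
  -- A positive limit would give |u n| ≥ L / n eventually, and the harmonic series would converge.
  have hL : L = 0 := by
    by_contra hne
    have hLpos : 0 < L := lt_of_le_of_ne hL0 (Ne.symm hne)
    have hle : ∀ n, L ≤ w n := fun n =>
      ciInf_le ⟨0, by rintro _ ⟨n, rfl⟩; exact hw0 n⟩ n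
    have hs : Summable fun n : ℕ => (((n + N : ℕ) : ℝ))⁻¹ := by
      refine Summable.of_nonneg_of_le (fun n => by positivity) (fun n => ?_) (hvs.mul_left L⁻¹)
      have h1 := hle n
      have hpos : (0 : ℝ) < ((n + N : ℕ) : ℝ) := by
        by_contra hc
        have : ((n + N : ℕ) : ℝ) = 0 := le_antisymm (not_lt.1 hc) (by positivity)
        simp only [hw] at h1
        push_cast at this
        rw [this] at h1
        linarith
      rw [inv_eq_one_div, div_le_iff₀ hpos, mul_assoc, ← div_eq_inv_mul, le_div_iff₀ hLpos]
      simp only [hw] at h1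
      simp only [hv]
      push_cast
      linarith
    exact Real.not_summable_natCast_inv ((summable_nat_add_iff N).1 hs)
  rw [hL] at hlim
  have h2 : Tendsto (fun n : ℕ => (n : ℝ) * |u n|) atTop (𝓝 0) := by
    refine (tendsto_add_atTop_iff_nat N).1 (hlim.congr fun n => ?_)
    simp [hw]
  rw [tendsto_zero_iff_norm_tendsto_zero]
  refine h2.congr fun n => ?_
  simp

/-- The terms behave like those of ₃F₂(p, q, a; r, s; 1), which converges when the excess r + s - p
- q - a is positive. -/
theorem raabe_test_of_ratio {u : ℕ → ℝ} {p q a r s : ℝ} (h : 0 < r + s - p - q - a)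
    (hu : ∀ n : ℕ, u (n + 1) * ((r + n) * (1 + n) * (s + n)) = (p + n) * (q + n) * (a + n) * u n) :
    Summable (fun n => |u n|) ∧ Tendsto (fun n : ℕ => n * u n) atTop (𝓝 0) := by
  -- With half of the excess, the cubic difference in `key` loses its n³ term and keeps δ as its
  -- coefficient of n², so it is eventually nonnegative.
  set δ := (r + s - p - q - a) / 2 with hδ
  have hδ0 : 0 < δ := by positivity
  refine raabe_test hδ0 ?_
  filter_upwards [eventually_quadratic_nonneg hδ0 (r * s - δ * (r + s) - (p * q + p * a + q * a))
    (-δ * r * s - p * q * a), (tendsto_natCast_add_atTop r).eventually_gt_atTop 0,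
    (tendsto_natCast_add_atTop s).eventually_gt_atTop 0,
    (tendsto_natCast_add_atTop p).eventually_gt_atTop 0,
    (tendsto_natCast_add_atTop q).eventually_gt_atTop 0,
    (tendsto_natCast_add_atTop a).eventually_gt_atTop 0] with n h0 hr hs hp hq ha
  have hn : (0 : ℝ) < 1 + n := by positivity
  have e : |u (n + 1)| * ((r + n) * (1 + n) * (s + n)) = (p + n) * (q + n) * (a + n) * |u n| := by
    have := congrArg abs (hu n)
    rwa [abs_mul, abs_mul _ (u n), abs_of_pos (by positivity : 0 < (r + n) * (1 + n) * (s + n)),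
      abs_of_pos (by positivity : 0 < (p + n) * (q + n) * (a + n))] at this
  have hrs : 0 < (r + n) * (s + n) := by positivity
  have key : (p + n) * (q + n) * (a + n) ≤ (n - δ) * ((r + n) * (s + n)) := by
    have : r = 2 * δ - s + p + q + a := by rw [hδ]; ring
    have e2 : (n - δ) * ((r + n) * (s + n)) - (p + n) * (q + n) * (a + n)
        = δ * (n : ℝ) ^ 2 + (r * s - δ * (r + s) - (p * q + p * a + q * a)) * n
          + (-δ * r * s - p * q * a) := by
      linear_combination (n : ℝ) ^ 2 * this
    linarith
  have : ((n : ℝ) + 1) * |u (n + 1)| ≤ (n - δ) * |u n| := by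
    refine le_of_mul_le_mul_right ?_ hrs
    calc ((n : ℝ) + 1) * |u (n + 1)| * ((r + n) * (s + n))
        = (p + n) * (q + n) * (a + n) * |u n| := by rw [← e]; ring
      _ ≤ (n - δ) * ((r + n) * (s + n)) * |u n| :=
          mul_le_mul_of_nonneg_right key (abs_nonneg _)
      _ = _ := by ring
  linarith

end Convergence

/-! ### Coefficients of ₂F₁, their recursion, and the binomial series. -/

section Coefficients

open Filter Topology

/-- The coefficients of `₂F₁(p, q; r; ·)`. -/
noncomputable def hgCoeff (p q r : ℝ) (n : ℕ) : ℝ := ordinaryHypergeometricCoefficient p q r n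

@[simp]
theorem hgCoeff_zero (p q r : ℝ) : hgCoeff p q r 0 = 1 := by
  simp [hgCoeff, ordinaryHypergeometricCoefficient]

theorem add_natCast_ne_zero {r : ℝ} (hr : ∀ n : ℕ, r ≠ -(n : ℝ)) (n : ℕ) : r + n ≠ 0 :=
  fun h => hr n (by linarith)

theorem ne_neg_natCast_of_pos {r : ℝ} (hr : 0 < r) (n : ℕ) : r ≠ -(n : ℝ) := by
  have : (0 : ℝ) ≤ n := n.cast_nonneg
  intro h
  linarith

theorem hgCoeff_succ {p q r : ℝ} (hr : ∀ n : ℕ, r ≠ -(n : ℝ)) (n : ℕ) :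
    (n + 1) * (r + n) * hgCoeff p q r (n + 1) = (p + n) * (q + n) * hgCoeff p q r n := by
  have h1 := add_natCast_ne_zero hr n
  have h2 : (ascPochhammer ℝ n).eval r ≠ 0 := by
    rw [Ne, ascPochhammer_eval_eq_zero_iff]
    rintro ⟨k, -, hk⟩
    exact hr k (by linarith)
  have h3 : ((n.factorial : ℕ) : ℝ) ≠ 0 := by exact_mod_cast n.factorial_ne_zero
  have h4 : ((n : ℝ) + 1) ≠ 0 := by positivity
  simp only [hgCoeff, ordinaryHypergeometricCoefficient, ascPochhammer_succ_eval,
    Nat.factorial_succ]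
  push_cast
  field_simp

/-- Since r + n never vanishes, the recursion determines the sequence. This identifies both the
product series in Euler's transformation and the expansion in y of the one-step density. -/
theorem eq_hgCoeff_of_succ {p q r : ℝ} (hr : ∀ n : ℕ, r ≠ -(n : ℝ)) {g : ℕ → ℝ} (h0 : g 0 = 1)
    (h : ∀ n : ℕ, (n + 1) * (r + n) * g (n + 1) = (p + n) * (q + n) * g n) (n : ℕ) :
    g n = hgCoeff p q r n := by
  induction n with
  | zero => simpa using h0
  | succ n ih =>
    have h1 := add_natCast_ne_zero hr n
    have h4 : ((n : ℝ) + 1) ≠ 0 := by positivity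
    refine mul_left_cancel₀ (mul_ne_zero h4 h1) ?_
    rw [h, hgCoeff_succ hr, ih]

theorem hgCoeff_pos {p q r : ℝ} (hp : 0 < p) (hq : 0 < q) (hr : 0 < r) (n : ℕ) :
    0 < hgCoeff p q r n := by
  simp only [hgCoeff, ordinaryHypergeometricCoefficient]
  have h1 := ascPochhammer_pos n p hp
  have h2 := ascPochhammer_pos n q hq
  have h3 := ascPochhammer_pos n r hr
  positivity

/-- Ratio test with some ρ between |x| and 1: the quadratic ρ(n+1)(r+n) - |x|(p+n)(q+n) has leading
coefficient ρ - |x| > 0. -/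
theorem summable_hgCoeff_mul_pow {p q r : ℝ} (hr : ∀ n : ℕ, r ≠ -(n : ℝ)) {x : ℝ} (hx : |x| < 1) :
    Summable fun n => ‖hgCoeff p q r n * x ^ n‖ := by
  obtain ⟨ρ, h1, h2⟩ := exists_between hx
  refine summable_of_ratio_norm_eventually_le h2 ?_
  filter_upwards [eventually_quadratic_nonneg (sub_pos.2 h1) (ρ * (1 + r) - |x| * (p + q))
    (ρ * r - |x| * (p * q)), (tendsto_natCast_add_atTop r).eventually_gt_atTop 0,
    (tendsto_natCast_add_atTop p).eventually_gt_atTop 0,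
    (tendsto_natCast_add_atTop q).eventually_gt_atTop 0] with n h0 hr' hp hq
  have hn : (0 : ℝ) < n + 1 := by positivity
  have e := congrArg abs (hgCoeff_succ (p := p) (q := q) hr n)
  rw [abs_mul, abs_mul _ (hgCoeff p q r n), abs_of_pos (by positivity : 0 < ((n : ℝ) + 1) * (r + n)),
    abs_of_pos (by positivity : 0 < (p + n) * (q + n))] at e
  have hpos : 0 < ((n : ℝ) + 1) * (r + n) := by positivity
  rw [norm_norm, norm_norm]
  simp only [norm_mul, norm_pow, Real.norm_eq_abs]
  refine le_of_mul_le_mul_left ?_ hpos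
  calc ((n : ℝ) + 1) * (r + n) * (|hgCoeff p q r (n + 1)| * |x| ^ (n + 1))
      = (|x| * ((p + n) * (q + n))) * (|hgCoeff p q r n| * |x| ^ n) := by
        rw [← mul_assoc, e]; ring
    _ ≤ (ρ * ((n + 1) * (r + n))) * (|hgCoeff p q r n| * |x| ^ n) := by
        refine mul_le_mul_of_nonneg_right ?_ (by positivity)
        linarith
    _ = _ := by ring

theorem ordinaryHypergeometric_eq_tsum_hgCoeff (p q r x : ℝ) :
    ordinaryHypergeometric p q r x = ∑' n, hgCoeff p q r n * x ^ n := by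
  rw [ordinaryHypergeometric_eq_tsum]
  rfl

theorem hasSum_ordinaryHypergeometric {p q r : ℝ} (hr : ∀ n : ℕ, r ≠ -(n : ℝ)) {x : ℝ}
    (hx : |x| < 1) :
    HasSum (fun n => hgCoeff p q r n * x ^ n) (ordinaryHypergeometric p q r x) := by
  rw [ordinaryHypergeometric_eq_tsum_hgCoeff]
  exact (summable_hgCoeff_mul_pow hr hx).of_norm.hasSum

theorem ordinaryHypergeometric_comm (p q r x : ℝ) :
    ordinaryHypergeometric p q r x = ordinaryHypergeometric q p r x := by
  rw [ordinaryHypergeometric, ordinaryHypergeometricSeries_symm, ← ordinaryHypergeometric]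

theorem ne_neg_natCast_one (n : ℕ) : (1 : ℝ) ≠ -(n : ℝ) := ne_neg_natCast_of_pos one_pos n

/-- The binomial series of (1 - x)^(-s) is treated as ₂F₁(s, 1; 1; x), so that the recursion and
summability results for `hgCoeff` cover it. -/
theorem hgCoeff_one_one (s : ℝ) (n : ℕ) :
    hgCoeff s 1 1 n = (ascPochhammer ℝ n).eval s / n.factorial := by
  have : (ascPochhammer ℝ n).eval 1 ≠ 0 := (ascPochhammer_pos n 1 one_pos).ne'
  simp only [hgCoeff, ordinaryHypergeometricCoefficient]
  field_simp

theorem ordinaryHypergeometric_one_one (s : ℝ) {x : ℝ} (hx : |x| < 1) :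
    ordinaryHypergeometric s 1 1 x = (1 - x) ^ (-s) := by
  have h := (Real.one_div_one_sub_rpow_hasFPowerSeriesOnBall_zero s).hasSum (y := x)
    (by simpa [Real.enorm_eq_ofReal_abs] using hx)
  have h2 := hasSum_ordinaryHypergeometric (p := s) (q := 1) ne_neg_natCast_one hx
  rw [Real.rpow_neg (by linarith [(abs_lt.1 hx).2]), ← one_div]
  simp only [zero_add] at h
  convert! h2.unique ?_
  convert! h using 2 with n
  have hf : ((n.factorial : ℕ) : ℝ) ≠ 0 := by exact_mod_cast n.factorial_ne_zero
  have := Ring.factorial_nsmul_multichoose_eq_ascPochhammer s n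
  rw [nsmul_eq_mul, Polynomial.ascPochhammer_smeval_eq_eval] at this
  rw [FormalMultilinearSeries.ofScalars_apply_eq, smul_eq_mul, hgCoeff_one_one, ← this,
    Ring.choose, mul_div_cancel_left₀ _ hf]
  congr 2
  ring

end Coefficients

/-! ### Euler's transformation through formal power series. -/

section Euler

open PowerSeries

/-- The Euler operator `X * d/dX` on power series. -/
noncomputable def eulerOp (f : ℝ⟦X⟧) : ℝ⟦X⟧ := X * d⁄dX ℝ f

theorem coeff_eulerOp (f : ℝ⟦X⟧) (n : ℕ) : coeff n (eulerOp f) = n * coeff n f := by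
  cases n with
  | zero => simp [eulerOp]
  | succ n => rw [eulerOp, coeff_succ_X_mul, coeff_derivative]; push_cast; ring

theorem eulerOp_mul (f g : ℝ⟦X⟧) : eulerOp (f * g) = eulerOp f * g + f * eulerOp g := by
  rw [eulerOp, eulerOp, eulerOp, Derivation.leibniz]
  simp only [smul_eq_mul]
  ring

theorem eulerOp_add (f g : ℝ⟦X⟧) : eulerOp (f + g) = eulerOp f + eulerOp g := by
  rw [eulerOp, eulerOp, eulerOp, map_add, mul_add]

theorem eulerOp_sub (f g : ℝ⟦X⟧) : eulerOp (f - g) = eulerOp f - eulerOp g := by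
  rw [eulerOp, eulerOp, eulerOp, map_sub, mul_sub]

theorem eulerOp_X : eulerOp X = X := by
  rw [eulerOp, derivative_X, mul_one]

theorem eulerOp_C (c : ℝ) : eulerOp (C c) = 0 := by
  rw [eulerOp, derivative_C, mul_zero]

theorem eulerOp_one : eulerOp 1 = 0 := by
  simpa using eulerOp_C 1

/-- The hypergeometric equation, written with the Euler operator. -/
theorem hypergeometric_equation_iff (p q r : ℝ) (f : ℝ⟦X⟧) :
    eulerOp (eulerOp f) + C (r - 1) * eulerOp f
      = X * (eulerOp (eulerOp f) + C (p + q) * eulerOp f + C (p * q) * f) ↔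
    ∀ n : ℕ, (n + 1) * (r + n) * coeff (n + 1) f = (p + n) * (q + n) * coeff n f := by
  have hadd (n : ℕ) (f g : ℝ⟦X⟧) : coeff n (f + g) = coeff n f + coeff n g := map_add _ _ _
  rw [PowerSeries.ext_iff]
  constructor
  · intro h n
    -- The recursion at n is the coefficient of X^(n+1); the constant coefficients agree trivially.
    have := h (n + 1)
    rw [coeff_succ_X_mul] at this
    simp only [hadd, coeff_eulerOp, coeff_C_mul] at this
    push_cast at this
    linear_combination this
  · intro h n
    cases n with
    | zero => simp [eulerOp]
    | succ n =>
      rw [coeff_succ_X_mul]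
      simp only [hadd, coeff_eulerOp, coeff_C_mul]
      push_cast
      linear_combination h n

/-- The product of ₂F₁(r-p, r-q; r; X) and (1 - X)^(-(p+q-r)) solves the hypergeometric equation
with parameters p, q, r and has constant term 1, hence has the coefficients of ₂F₁(p, q; r; X). -/
theorem hgCoeff_euler {p q r : ℝ} (hr : ∀ n : ℕ, r ≠ -(n : ℝ)) (n : ℕ) :
    hgCoeff p q r n = ∑ kl ∈ Finset.HasAntidiagonal.antidiagonal n,
      hgCoeff (r - p) (r - q) r kl.1 * hgCoeff (p + q - r) 1 1 kl.2 := by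
  set A : ℝ⟦X⟧ := PowerSeries.mk (hgCoeff (r - p) (r - q) r) with hA
  set B : ℝ⟦X⟧ := PowerSeries.mk (hgCoeff (p + q - r) 1 1) with hB
  have eA := (hypergeometric_equation_iff (r - p) (r - q) r A).2 fun n => by
    simpa [hA] using hgCoeff_succ hr n
  have eB : (1 - X) * eulerOp B = C (p + q - r) * (X * B) := by
    ext n
    rw [sub_mul, one_mul, map_sub, coeff_C_mul, coeff_eulerOp]
    cases n with
    | zero => simp
    | succ n =>
      rw [coeff_succ_X_mul, coeff_succ_X_mul, coeff_eulerOp]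
      have := hgCoeff_succ (p := p + q - r) (q := 1) ne_neg_natCast_one n
      have h4 : ((n : ℝ) + 1) ≠ 0 := by positivity
      simp only [hB, coeff_mk]
      push_cast
      refine mul_left_cancel₀ h4 ?_
      linear_combination this
  -- The first-order equation of the binomial factor, differentiated once more, expresses the second
  -- derivative occurring in the product rule.
  have eB' := congrArg eulerOp eB
  simp only [eulerOp_mul, eulerOp_sub, eulerOp_X, eulerOp_C, eulerOp_one] at eB'
  have eG := (hypergeometric_equation_iff p q r (A * B)).1 (by
    simp only [eulerOp_mul, eulerOp_add]
    simp only [map_sub, map_add, map_mul, map_one] at eA eB eB' ⊢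
    linear_combination B * eA + A * eB' + (2 * eulerOp A + A * (C r - 1)) * eB)
  have := eq_hgCoeff_of_succ (g := fun n => coeff n (A * B)) hr
    (by simp [hA, hB, coeff_mul]) eG n
  rw [← this]
  simp only [coeff_mul, hA, hB, coeff_mk]

/-- Euler's transformation of `₂F₁`. -/
theorem ordinaryHypergeometric_euler {p q r : ℝ} (hr : ∀ n : ℕ, r ≠ -(n : ℝ)) {x : ℝ}
    (hx : |x| < 1) :
    ordinaryHypergeometric p q r x
      = (1 - x) ^ (r - p - q) * ordinaryHypergeometric (r - p) (r - q) r x := by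
  have h1 := summable_hgCoeff_mul_pow (p := r - p) (q := r - q) hr hx
  have h2 := summable_hgCoeff_mul_pow (p := p + q - r) (q := 1) ne_neg_natCast_one hx
  rw [show r - p - q = -(p + q - r) by ring, ← ordinaryHypergeometric_one_one _ hx,
    ordinaryHypergeometric_eq_tsum_hgCoeff, ordinaryHypergeometric_eq_tsum_hgCoeff,
    ordinaryHypergeometric_eq_tsum_hgCoeff (r - p), mul_comm,
    tsum_mul_tsum_eq_tsum_sum_antidiagonal_of_summable_norm h1 h2]
  refine tsum_congr fun n => ?_
  rw [hgCoeff_euler hr, Finset.sum_mul]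
  refine Finset.sum_congr rfl fun kl hkl => ?_
  rw [← Finset.HasAntidiagonal.mem_antidiagonal.1 hkl, pow_add]
  ring

end Euler

/-! ### Beta integrals and termwise integration. -/

section BetaIntegral

theorem integrableOn_beta {a b : ℝ} (ha : 0 < a) (hb : 0 < b) :
    IntegrableOn (fun x : ℝ => x ^ (a - 1) * (1 - x) ^ (b - 1)) (Ioo 0 1) ∧
      ∫ x in Ioo (0 : ℝ) 1, x ^ (a - 1) * (1 - x) ^ (b - 1) = beta a b := by
  have hβ := beta_pos ha hb
  have h := lintegral_betaPDF_eq_one ha hb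
  rw [lintegral_betaPDF] at h
  have hnn : 0 ≤ᵐ[volume.restrict (Ioo (0 : ℝ) 1)]
      fun x : ℝ => 1 / beta a b * x ^ (a - 1) * (1 - x) ^ (b - 1) := by
    filter_upwards [ae_restrict_mem measurableSet_Ioo] with x hx
    have h1 : 0 < x := hx.1
    have h2 : 0 < 1 - x := sub_pos.2 hx.2
    simp only [Pi.zero_apply]
    positivity
  have hm : AEStronglyMeasurable (fun x : ℝ => 1 / beta a b * x ^ (a - 1) * (1 - x) ^ (b - 1))
      (volume.restrict (Ioo (0 : ℝ) 1)) := by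
    exact (by fun_prop : Measurable
      (fun x : ℝ => 1 / beta a b * x ^ (a - 1) * (1 - x) ^ (b - 1))).aestronglyMeasurable
  have hint := integral_eq_lintegral_of_nonneg_ae hnn hm
  rw [h, ENNReal.toReal_one] at hint
  have hI : Integrable (fun x : ℝ => 1 / beta a b * x ^ (a - 1) * (1 - x) ^ (b - 1))
      (volume.restrict (Ioo (0 : ℝ) 1)) :=
    ⟨hm, (hasFiniteIntegral_iff_ofReal hnn).2 (by rw [h]; exact ENNReal.one_lt_top)⟩
  have e : (fun x : ℝ => x ^ (a - 1) * (1 - x) ^ (b - 1))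
      = fun x : ℝ => beta a b * (1 / beta a b * x ^ (a - 1) * (1 - x) ^ (b - 1)) := by
    funext x
    field_simp
  rw [IntegrableOn, e]
  refine ⟨hI.const_mul _, ?_⟩
  rw [integral_const_mul, hint, mul_one]

theorem beta_add_one_left {a b : ℝ} (ha : 0 < a) (hb : 0 < b) :
    beta (a + 1) b * (a + b) = a * beta a b := by
  have h1 := (Real.Gamma_pos_of_pos (add_pos ha hb)).ne'
  have h2 := (add_pos ha hb).ne'
  rw [beta, beta, show a + 1 + b = a + b + 1 by ring, Real.Gamma_add_one ha.ne',
    Real.Gamma_add_one h2]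
  field_simp

theorem beta_add_one_right {a b : ℝ} (ha : 0 < a) (hb : 0 < b) :
    beta a (b + 1) * (a + b) = b * beta a b := by
  have h1 := (Real.Gamma_pos_of_pos (add_pos ha hb)).ne'
  have h2 := (add_pos ha hb).ne'
  rw [beta, beta, ← add_assoc, Real.Gamma_add_one hb.ne', Real.Gamma_add_one h2]
  field_simp

end BetaIntegral

theorem integrable_tsum_of_summable_integral_norm {α : Type*} [MeasurableSpace α] {μ : Measure α}
    {F : ℕ → α → ℝ} (hF : ∀ n, Integrable (F n) μ)
    (hs : Summable fun n => ∫ a, ‖F n a‖ ∂μ) : Integrable (fun a => ∑' n, F n a) μ := by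
  refine ⟨(AEMeasurable.tsum fun n => (hF n).1.aemeasurable).aestronglyMeasurable, ?_⟩
  rw [hasFiniteIntegral_iff_enorm]
  calc ∫⁻ a, ‖∑' n, F n a‖ₑ ∂μ ≤ ∫⁻ a, ∑' n, ‖F n a‖ₑ ∂μ :=
        lintegral_mono fun a => enorm_tsum_le_tsum_enorm
    _ = ∑' n, ∫⁻ a, ‖F n a‖ₑ ∂μ := lintegral_tsum fun n => (hF n).1.enorm
    _ = ∑' n, ENNReal.ofReal (∫ a, ‖F n a‖ ∂μ) := by
        simp_rw [ofReal_integral_norm_eq_lintegral_enorm (hF _)]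
    _ < ⊤ := hs.tsum_ofReal_lt_top

/-! ### Integrals of the beta-hypergeometric density and Gauss's contiguity relation. -/

section BHIntegral

open Filter Topology

theorem measurable_ordinaryHypergeometric (p q r : ℝ) :
    Measurable fun x : ℝ => ordinaryHypergeometric p q r x := by
  simp_rw [ordinaryHypergeometric_eq_tsum_hgCoeff]
  fun_prop

theorem measurable_bhFun (a b p q r : ℝ) : Measurable (bhFun a b p q r) := by
  unfold bhFun
  have := measurable_ordinaryHypergeometric p q r
  fun_prop

variable {a b p q r : ℝ}

theorem hgCoeff_mul_beta_succ (hr : ∀ n : ℕ, r ≠ -(n : ℝ)) (ha : 0 < a) (hb : 0 < b) (n : ℕ) :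
    hgCoeff p q r (n + 1) * beta (a + (n + 1 : ℕ)) b * ((r + n) * (1 + n) * (a + b + n))
      = (p + n) * (q + n) * (a + n) * (hgCoeff p q r n * beta (a + n) b) := by
  have h1 := beta_add_one_left (a := a + n) (by positivity) hb
  have h2 := hgCoeff_succ (p := p) (q := q) hr n
  push_cast
  rw [← add_assoc]
  linear_combination beta (a + n + 1) b * (a + n + b) * h2
    + (p + n) * (q + n) * hgCoeff p q r n * h1

theorem integrableOn_bhFun_and_hasSum (hr : ∀ n : ℕ, r ≠ -(n : ℝ)) (ha : 0 < a) (hb : 0 < b)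
    (h : 0 < r + b - p - q) :
    IntegrableOn (bhFun a b p q r) (Ioo 0 1) ∧
      HasSum (fun n : ℕ => hgCoeff p q r n * beta (a + n) b)
        (∫ x in Ioo (0 : ℝ) 1, bhFun a b p q r x) := by
  -- With s = a + b the excess is r + b - p - q, so this admissibility condition is what makes
  -- termwise integration absolutely convergent.
  have hsum := (raabe_test_of_ratio (u := fun n : ℕ => hgCoeff p q r n * beta (a + n) b)
    (p := p) (q := q) (a := a) (r := r) (s := a + b) (by linarith)
    (hgCoeff_mul_beta_succ hr ha hb)).1
  set F : ℕ → ℝ → ℝ := fun n x =>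
    hgCoeff p q r n * (x ^ (a + n - 1) * (1 - x) ^ (b - 1)) with hF
  have han : ∀ n : ℕ, 0 < a + n := fun n => by positivity
  have hFi : ∀ n, Integrable (F n) (volume.restrict (Ioo (0 : ℝ) 1)) := fun n =>
    (integrableOn_beta (han n) hb).1.const_mul _
  have hFn : ∀ n, ∫ x in Ioo (0 : ℝ) 1, ‖F n x‖ = |hgCoeff p q r n * beta (a + n) b| := by
    intro n
    rw [abs_mul, abs_of_pos (beta_pos (han n) hb), ← (integrableOn_beta (han n) hb).2,
      ← integral_const_mul]
    refine setIntegral_congr_fun measurableSet_Ioo fun x hx => ?_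
    have h1 : 0 < x := hx.1
    have h2 : 0 < 1 - x := sub_pos.2 hx.2
    simp only [hF, norm_mul, Real.norm_eq_abs]
    rw [abs_of_pos (Real.rpow_pos_of_pos h1 _), abs_of_pos (Real.rpow_pos_of_pos h2 _)]
  have hFs : Summable fun n => ∫ x in Ioo (0 : ℝ) 1, ‖F n x‖ := by simpa only [hFn] using hsum
  have hFt : EqOn (fun x => ∑' n, F n x) (bhFun a b p q r) (Ioo 0 1) := by
    intro x hx
    simp only [hF, bhFun]
    rw [ordinaryHypergeometric_eq_tsum_hgCoeff, ← tsum_mul_left]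
    refine tsum_congr fun n => ?_
    rw [show a + (n : ℝ) - 1 = a - 1 + n by ring, Real.rpow_add hx.1, Real.rpow_natCast]
    ring
  constructor
  · exact (integrableOn_congr_fun hFt measurableSet_Ioo).1
      (integrable_tsum_of_summable_integral_norm hFi hFs)
  · rw [← setIntegral_congr_fun measurableSet_Ioo hFt]
    refine (hasSum_integral_of_summable_integral_norm hFi hFs).congr_fun ?_
    intro n
    simp only [hF]
    rw [integral_const_mul, (integrableOn_beta (han n) hb).2]

theorem bhFun_pos {x : ℝ} (hx : x ∈ Ioo (0 : ℝ) 1) (hF : 0 < ordinaryHypergeometric p q r x) :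
    0 < bhFun a b p q r x :=
  mul_pos (mul_pos (Real.rpow_pos_of_pos hx.1 _) (Real.rpow_pos_of_pos (sub_pos.2 hx.2) _)) hF

theorem integral_bhFun_pos (h : BHAdmissible a b p q r) :
    0 < ∫ x in Ioo (0 : ℝ) 1, bhFun a b p q r x := by
  obtain ⟨hr, hF, ha, hb, hd⟩ := h
  rw [setIntegral_pos_iff_support_of_nonneg_ae _ (integrableOn_bhFun_and_hasSum hr ha hb hd).1]
  · refine lt_of_lt_of_le ?_ (measure_mono (s := Ioo (0 : ℝ) 1) fun x hx =>
      ⟨(bhFun_pos hx (hF x hx)).ne', hx⟩)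
    simp
  · filter_upwards [ae_restrict_mem measurableSet_Ioo] with x hx
    exact (bhFun_pos hx (hF x hx)).le

/-- The contiguity relation behind Gauss's evaluation of `₂F₁(p, q; r + b; 1)`. -/
theorem integral_bhFun_add_one (hr : 0 < r) (hb : 0 < b) (h : 0 < r + b - p - q) :
    (r + b - p) * (r + b - q) * ∫ x in Ioo (0 : ℝ) 1, bhFun r (b + 1) p q r x
      = b * (r + b - p - q) * ∫ x in Ioo (0 : ℝ) 1, bhFun r b p q r x := by
  have hr' := ne_neg_natCast_of_pos hr
  have s0 := (integrableOn_bhFun_and_hasSum (a := r) (p := p) (q := q) hr' hr hb h).2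
  have s1 := (integrableOn_bhFun_and_hasSum (a := r) (b := b + 1) (p := p) (q := q) hr' hr
    (by linarith) (by linarith)).2
  have hratio := hgCoeff_mul_beta_succ (p := p) (q := q) hr' hr hb
  set t : ℕ → ℝ := fun n => hgCoeff p q r n * beta (r + n) b with ht
  have hlim := (raabe_test_of_ratio (u := t) (p := p) (q := q) (a := r) (r := r) (s := r + b)
    (by linarith) hratio).2
  have s2 := ((s1.mul_left ((r + b - p) * (r + b - q))).sub
    (s0.mul_left (b * (r + b - p - q)))).tendsto_sum_nat
  rw [← sub_eq_zero]
  -- The termwise difference telescopes, with primitive b m t(m). The boundary term vanishes at 0,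
  -- and at infinity by Raabe's test.
  have e : ∀ n : ℕ, (r + b - p) * (r + b - q) * (hgCoeff p q r n * beta (r + n) (b + 1))
      - b * (r + b - p - q) * t n
      = (fun m : ℕ => b * (m * t m)) (n + 1) - (fun m : ℕ => b * (m * t m)) n := by
    intro n
    have hn : 0 < r + n := by positivity
    have h1 := beta_add_one_right hn hb
    have h2 : r + b + n ≠ 0 := by positivity
    have h3 := hratio n
    refine mul_right_cancel₀ (mul_ne_zero h2 hn.ne') ?_
    simp only [ht] at h3 ⊢
    push_cast at h3 ⊢
    linear_combination (r + b - p) * (r + b - q) * hgCoeff p q r n * (r + n) * h1 - b * h3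
  refine tendsto_nhds_unique s2 (Tendsto.congr (f₁ := fun n : ℕ => b * (n * t n)) (fun n => ?_)
    (by simpa using hlim.const_mul b))
  rw [Finset.sum_congr rfl fun i _ => e i, Finset.sum_range_sub (fun m : ℕ => b * (m * t m))]
  simp

/-- Expand (1 - y(1-x))^(-s), s = r + b - q, as a binomial series in y(1-x). Each power of 1 - x
raises b by one, and the contiguity relation turns the resulting coefficients into hypergeometric
ones. -/
theorem integral_bhFun_mul_rpow (hr : 0 < r) (hb : 0 < b) (h : 0 < r + b - p - q)
    (hq : 0 < r + b - q) (hF : ∀ x ∈ Ioo (0 : ℝ) 1, 0 < ordinaryHypergeometric p q r x) {y : ℝ}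
    (hy : y ∈ Ioo (0 : ℝ) 1) :
    0 < r + b - p ∧
    IntegrableOn (fun x => bhFun r b p q r x * (1 - y * (1 - x)) ^ (-(r + b - q))) (Ioo 0 1) ∧
    ∫ x in Ioo (0 : ℝ) 1, bhFun r b p q r x * (1 - y * (1 - x)) ^ (-(r + b - q))
      = (∫ x in Ioo (0 : ℝ) 1, bhFun r b p q r x)
        * ordinaryHypergeometric b (r + b - p - q) (r + b - p) y := by
  have hr' := ne_neg_natCast_of_pos hr
  set J : ℝ → ℝ := fun b => ∫ x in Ioo (0 : ℝ) 1, bhFun r b p q r x with hJ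
  have hn0 : ∀ n : ℕ, (0 : ℝ) ≤ n := fun n => n.cast_nonneg
  have hJpos : ∀ n : ℕ, 0 < J (b + n) := fun n =>
    integral_bhFun_pos ⟨hr', hF, hr, by linarith [hn0 n], by linarith [hn0 n]⟩
  have hJ0 : 0 < J b := by simpa using hJpos 0
  have hrec : ∀ n : ℕ, (r + b - p + n) * (r + b - q + n) * J (b + (n + 1 : ℕ))
      = (b + n) * (r + b - p - q + n) * J (b + n) := by
    intro n
    have := integral_bhFun_add_one (p := p) (q := q) hr (b := b + n) (by linarith [hn0 n])
      (by linarith [hn0 n])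
    simp only [hJ]
    push_cast
    rw [← add_assoc]
    linear_combination this
  -- The contiguity relation with n = 0 equates (r+b-p)(r+b-q)J(b+1) with a positive quantity, and
  -- the other two factors are positive.
  have hp : 0 < r + b - p := by
    have h0 := hrec 0
    have h1 := hJpos 1
    simp only [Nat.cast_zero, add_zero, zero_add] at h0
    have h2 : 0 < (r + b - p) * ((r + b - q) * J (b + (1 : ℕ))) := by
      rw [← mul_assoc, h0]; positivity
    exact (pos_iff_pos_of_mul_pos h2).2 (by positivity)
  have hp' := ne_neg_natCast_of_pos hp
  set s := r + b - q with hs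
  have hcoef : ∀ n : ℕ, hgCoeff s 1 1 n * J (b + n)
      = J b * hgCoeff b (r + b - p - q) (r + b - p) n := by
    intro n
    rw [← eq_hgCoeff_of_succ (g := fun n : ℕ => hgCoeff s 1 1 n * J (b + n) / J b) hp']
    · field_simp
    · simp [hJ0.ne']
    · intro n
      have h1 := hgCoeff_succ (p := s) (q := 1) ne_neg_natCast_one n
      have h2 := hrec n
      have h3 : (s + n) * (1 + (n : ℝ)) ≠ 0 := by have := hn0 n; positivity
      rw [← mul_div_assoc, ← mul_div_assoc]
      congr 1
      refine mul_right_cancel₀ h3 ?_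
      linear_combination (r + b - p + n) * J (b + (n + 1 : ℕ)) * (s + n) * h1
        + (s + n) * (1 + n) * hgCoeff s 1 1 n * h2
  set F : ℕ → ℝ → ℝ := fun n x => hgCoeff s 1 1 n * y ^ n * bhFun r (b + n) p q r x with hFdef
  have hFi : ∀ n, Integrable (F n) (volume.restrict (Ioo (0 : ℝ) 1)) := fun n =>
    (integrableOn_bhFun_and_hasSum hr' hr (by linarith [hn0 n]) (by linarith [hn0 n])).1.const_mul _
  have hFint : ∀ n, ∫ x in Ioo (0 : ℝ) 1, F n x
      = J b * (hgCoeff b (r + b - p - q) (r + b - p) n * y ^ n) := by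
    intro n
    simp only [hFdef]
    rw [integral_const_mul, ← mul_assoc, ← hcoef]
    ring
  -- All terms are positive, so convergence of the target series at y < 1 already justifies
  -- exchanging sum and integral.
  have hFnorm : ∀ n, ∫ x in Ioo (0 : ℝ) 1, ‖F n x‖ = ∫ x in Ioo (0 : ℝ) 1, F n x := by
    intro n
    refine setIntegral_congr_fun measurableSet_Ioo fun x hx => ?_
    have h1 := hgCoeff_pos hq one_pos one_pos n
    have h2 : 0 < bhFun r (b + n) p q r x := bhFun_pos hx (hF x hx)
    have h3 := pow_pos hy.1 n
    simp only [hFdef]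
    exact Real.norm_of_nonneg (by positivity)
  have hyabs : |y| < 1 := abs_lt.2 ⟨by linarith [hy.1], hy.2⟩
  have hFs : Summable fun n => ∫ x in Ioo (0 : ℝ) 1, ‖F n x‖ := by
    simp only [hFnorm, hFint]
    exact (summable_hgCoeff_mul_pow hp' hyabs).of_norm.mul_left _
  have hFt : EqOn (fun x => ∑' n, F n x)
      (fun x => bhFun r b p q r x * (1 - y * (1 - x)) ^ (-s)) (Ioo 0 1) := by
    intro x hx
    have hyx : |y * (1 - x)| < 1 := by
      rw [abs_of_pos (mul_pos hy.1 (sub_pos.2 hx.2))]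
      nlinarith [hy.1, hy.2, hx.1, hx.2]
    simp only [hFdef]
    rw [← ordinaryHypergeometric_one_one s hyx, ordinaryHypergeometric_eq_tsum_hgCoeff s,
      ← tsum_mul_left]
    refine tsum_congr fun n => ?_
    simp only [bhFun]
    rw [show b + (n : ℝ) - 1 = b - 1 + n by ring, Real.rpow_add (sub_pos.2 hx.2),
      Real.rpow_natCast, mul_pow]
    ring
  refine ⟨hp, (integrableOn_congr_fun hFt measurableSet_Ioo).1
    (integrable_tsum_of_summable_integral_norm hFi hFs), ?_⟩
  rw [← setIntegral_congr_fun measurableSet_Ioo hFt]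
  refine (hasSum_integral_of_summable_integral_norm hFi hFs).unique ?_
  simp only [hFint]
  exact (hasSum_ordinaryHypergeometric hp' hyabs).mul_left _

end BHIntegral

/-! ### Dependence of the law on the vertex only. -/

section Symmetry

variable {a b p q r : ℝ}

theorem bhMeasure_congr {b' p' q' r' : ℝ}
    (h : EqOn (bhFun a b p q r) (bhFun a b' p' q' r') (Ioo 0 1)) :
    bhMeasure a b p q r = bhMeasure a b' p' q' r' := by
  unfold bhMeasure
  rw [setIntegral_congr_fun measurableSet_Ioo h]
  refine withDensity_congr_ae ?_
  filter_upwards [ae_restrict_mem measurableSet_Ioo] with x hx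
  rw [h hx]

theorem BHAdmissible.comm (h : BHAdmissible a b p q r) : BHAdmissible a b q p r := by
  obtain ⟨hr, hF, ha, hb, hd⟩ := h
  refine ⟨hr, fun x hx => ?_, ha, hb, by linarith⟩
  rw [ordinaryHypergeometric_comm]
  exact hF x hx

theorem bhMeasure_comm : bhMeasure a b p q r = bhMeasure a b q p r :=
  bhMeasure_congr fun x _ => by simp only [bhFun, ordinaryHypergeometric_comm p q]

theorem abs_lt_one_of_mem_Ioo {x : ℝ} (hx : x ∈ Ioo (0 : ℝ) 1) : |x| < 1 :=
  abs_lt.2 ⟨by linarith [hx.1], hx.2⟩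

theorem BHAdmissible.euler (h : BHAdmissible a b p q r) :
    BHAdmissible a (r + b - p - q) (r - p) (r - q) r := by
  obtain ⟨hr, hF, ha, hb, hd⟩ := h
  refine ⟨hr, fun x hx => ?_, ha, hd, by linarith⟩
  have := hF x hx
  rw [ordinaryHypergeometric_euler hr (abs_lt_one_of_mem_Ioo hx)] at this
  exact (pos_iff_pos_of_mul_pos this).1 (Real.rpow_pos_of_pos (sub_pos.2 hx.2) _)

theorem bhMeasure_euler (hr : ∀ n : ℕ, r ≠ -(n : ℝ)) :
    bhMeasure a b p q r = bhMeasure a (r + b - p - q) (r - p) (r - q) r :=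
  bhMeasure_congr fun x hx => by
    simp only [bhFun]
    rw [ordinaryHypergeometric_euler hr (abs_lt_one_of_mem_Ioo hx),
      show r + b - p - q - 1 = (b - 1) + (r - p - q) by ring, Real.rpow_add (sub_pos.2 hx.2)]
    ring

theorem isProbabilityMeasure_bhMeasure (h : BHAdmissible a b p q r) :
    IsProbabilityMeasure (bhMeasure a b p q r) := by
  have hZ := integral_bhFun_pos h
  obtain ⟨hr, hF, ha, hb, hd⟩ := h
  refine ⟨?_⟩
  rw [bhMeasure, withDensity_apply _ .univ, Measure.restrict_univ,
    ← ofReal_integral_eq_lintegral_ofReal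
      ((integrableOn_bhFun_and_hasSum hr ha hb hd).1.div_const _), integral_div, div_self hZ.ne',
    ENNReal.ofReal_one]
  filter_upwards [ae_restrict_mem measurableSet_Ioo] with x hx
  exact div_nonneg (bhFun_pos hx (hF x hx)).le hZ.le

namespace Theta

/-- Exchange of `θ₄` and `θ₅`. -/
def swapFourFive (t : Theta) : Theta := ⟨t.θ₁, t.θ₂, t.θ₃, t.θ₅, t.θ₄⟩

/-- Exchange of `θ₂` and `θ₃`. -/
def swapTwoThree (t : Theta) : Theta := ⟨t.θ₁, t.θ₃, t.θ₂, t.θ₄, t.θ₅⟩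

theorem BHExists.swapFourFive {t : Theta} (h : t.BHExists) :
    t.swapFourFive.BHExists ∧ t.swapFourFive.bh = t.bh := by
  have h1 := BHAdmissible.comm h
  have h2 := bhMeasure_comm (a := t.a) (b := t.b) (p := t.p) (q := t.q) (r := t.r)
  have ea : t.swapFourFive.a = t.a := add_comm _ _
  have er : t.swapFourFive.r = t.r := add_right_comm _ _ _
  have eb : t.swapFourFive.b = t.b := rfl
  have ep : t.swapFourFive.p = t.q := rfl
  have eq : t.swapFourFive.q = t.p := rfl
  rw [BHExists, bh, bh, ea, eb, ep, eq, er, h2]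
  exact ⟨h1, rfl⟩

theorem BHExists.swapTwoThree {t : Theta} (h : t.BHExists) :
    t.swapTwoThree.BHExists ∧ t.swapTwoThree.bh = t.bh := by
  have h1 := BHAdmissible.comm (BHAdmissible.euler h)
  have h2 := (bhMeasure_euler (a := t.a) (b := t.b) (p := t.p) (q := t.q) h.1).trans bhMeasure_comm
  have eb : t.swapTwoThree.b = t.r + t.b - t.p - t.q := by
    simp only [Theta.swapTwoThree, b, p, q, r]; ring
  have ep : t.swapTwoThree.p = t.r - t.q := by
    simp only [Theta.swapTwoThree, p, q, r]; ring
  have eq : t.swapTwoThree.q = t.r - t.p := by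
    simp only [Theta.swapTwoThree, p, q, r]; ring
  have er : t.swapTwoThree.r = t.r := by
    simp only [Theta.swapTwoThree, r]; ring
  have ea : t.swapTwoThree.a = t.a := rfl
  rw [BHExists, bh, bh, ea, eb, ep, eq, er, h2]
  exact ⟨h1, rfl⟩

/-- Representatives of one vertex differ by the two transpositions, which correspond to the symmetry
in p, q and to Euler's transformation. -/
theorem BHExists.of_vertex_eq {s t : Theta} (h : t.BHExists) (hst : s.vertex = t.vertex) :
    s.BHExists ∧ s.bh = t.bh := by
  obtain ⟨s₁, s₂, s₃, s₄, s₅⟩ := s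
  obtain ⟨t₁, t₂, t₃, t₄, t₅⟩ := t
  simp only [vertex, Prod.mk.injEq, Sym2.eq_iff] at hst
  obtain ⟨rfl, ⟨rfl, rfl⟩ | ⟨rfl, rfl⟩, ⟨rfl, rfl⟩ | ⟨rfl, rfl⟩⟩ := hst
  · exact ⟨h, rfl⟩
  · exact h.swapFourFive
  · exact h.swapTwoThree
  · have h1 := h.swapFourFive
    have h2 := h1.1.swapTwoThree
    exact ⟨h2.1, h2.2.trans h1.2⟩

end Theta

end Symmetry

/-! ### Effect of one random Moebius map on a beta-hypergeometric law. -/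

section OneStep

/-- For `W` of law `betaPrime c d`, the density at `y` of `1 / (1 + W x)`. -/
noncomputable def stepDensity (c d x y : ℝ) : ℝ :=
  1 / beta c d * (x ^ d * ((1 - y) ^ (c - 1) * y ^ (d - 1)) * (1 - y * (1 - x)) ^ (-(c + d)))

theorem one_sub_mul_one_sub_pos {x y : ℝ} (hx : 0 < x) (hy : y ∈ Ioo (0 : ℝ) 1) :
    0 < 1 - y * (1 - x) := by
  nlinarith [hy.1, hy.2, mul_pos hy.1 hx]

theorem stepDensity_pos {c d x y : ℝ} (hc : 0 < c) (hd : 0 < d) (hx : 0 < x)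
    (hy : y ∈ Ioo (0 : ℝ) 1) : 0 < stepDensity c d x y := by
  have h1 := beta_pos hc hd
  have h2 : 0 < y := hy.1
  have h3 : 0 < 1 - y := sub_pos.2 hy.2
  have h4 := one_sub_mul_one_sub_pos hx hy
  unfold stepDensity
  positivity

theorem measurable_stepDensity (c d : ℝ) :
    Measurable fun z : ℝ × ℝ => stepDensity c d z.1 z.2 := by
  unfold stepDensity
  fun_prop

theorem image_one_sub_div_mul {x : ℝ} (hx : 0 < x) :
    (fun y : ℝ => (1 - y) / (x * y)) '' Ioo 0 1 = Ioi 0 := by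
  ext w
  simp only [mem_image, mem_Ioi]
  constructor
  · rintro ⟨y, hy, rfl⟩
    exact div_pos (sub_pos.2 hy.2) (mul_pos hx hy.1)
  · intro hw
    have h : 0 < w * x := mul_pos hw hx
    refine ⟨1 / (1 + w * x), ⟨by positivity, ?_⟩, ?_⟩
    · rw [div_lt_one (by positivity)]
      linarith
    · field_simp
      ring

/-- Substitute w = (1 - y)/(x y), the inverse of y = 1/(1 + w x), with Jacobian 1/(x y²). -/
theorem lintegral_betaPrime_comp {c d x : ℝ} (hx : 0 < x) {f : ℝ → ENNReal} (hf : Measurable f) :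
    ∫⁻ w, f (1 / (1 + w * x)) ∂betaPrime c d
      = ∫⁻ y in Ioo (0 : ℝ) 1, ENNReal.ofReal (stepDensity c d x y) * f y := by
  have hderiv : ∀ y ∈ Ioo (0 : ℝ) 1,
      HasDerivWithinAt (fun y : ℝ => (1 - y) / (x * y)) (-(1 / (x * y ^ 2))) (Ioo 0 1) y := by
    intro y hy
    have hy0 : y ≠ 0 := hy.1.ne'
    have := (((hasDerivAt_id y).const_sub 1).div ((hasDerivAt_id y).const_mul x)
      (mul_ne_zero hx.ne' hy0)).hasDerivWithinAt (s := Ioo 0 1)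
    refine this.congr_deriv ?_
    simp only [id]
    field_simp
    ring
  have hinj : InjOn (fun y : ℝ => (1 - y) / (x * y)) (Ioo 0 1) := by
    intro y hy z hz h
    have hy0 : y ≠ 0 := hy.1.ne'
    have hz0 : z ≠ 0 := hz.1.ne'
    simp only at h
    field_simp at h
    linarith
  rw [betaPrime, lintegral_withDensity_eq_lintegral_mul _ (by fun_prop) (by fun_prop),
    ← image_one_sub_div_mul hx,
    lintegral_image_eq_lintegral_abs_deriv_mul measurableSet_Ioo hderiv hinj]
  refine setLIntegral_congr_fun measurableSet_Ioo fun y hy => ?_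
  have hy0 : 0 < y := hy.1
  have hy1 : 0 < 1 - y := sub_pos.2 hy.2
  have hQ := one_sub_mul_one_sub_pos hx hy
  have hxy : 0 < x * y := mul_pos hx hy0
  simp only [Pi.mul_apply]
  rw [← mul_assoc, ← ENNReal.ofReal_mul (abs_nonneg _), abs_neg,
    abs_of_pos (by positivity : 0 < 1 / (x * y ^ 2))]
  congr 2
  · rw [show 1 + (1 - y) / (x * y) = (1 - y * (1 - x)) / (x * y) by field_simp; ring,
      Real.div_rpow hy1.le hxy.le, Real.div_rpow hQ.le hxy.le, Real.mul_rpow hx.le hy0.le,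
      Real.mul_rpow hx.le hy0.le, stepDensity, Real.rpow_neg hQ.le,
      show x ^ (c + d) = x ^ d * x ^ (c - 1) * x by
        rw [← Real.rpow_add hx, ← Real.rpow_add_one hx.ne']; ring_nf,
      show y ^ (c + d) = y ^ (d - 1) * y ^ (c - 1) * y ^ 2 by
        rw [← Real.rpow_natCast y 2, ← Real.rpow_add hy0, ← Real.rpow_add hy0]
        push_cast
        ring_nf]
    have := (Real.rpow_pos_of_pos hx (c - 1)).ne'
    have := (Real.rpow_pos_of_pos hy0 (c - 1)).ne'
    have := (Real.rpow_pos_of_pos hQ (c + d)).ne'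
    field_simp
  · field_simp
    ring_nf

variable {a b p q r : ℝ}

theorem lintegral_bhMeasure {f : ℝ → ENNReal} (hf : Measurable f) :
    ∫⁻ x, f x ∂bhMeasure a b p q r = ∫⁻ x in Ioo (0 : ℝ) 1,
      ENNReal.ofReal (bhFun a b p q r x / ∫ y in Ioo (0 : ℝ) 1, bhFun a b p q r y) * f x := by
  have := measurable_bhFun a b p q r
  rw [bhMeasure, lintegral_withDensity_eq_lintegral_mul _ (by fun_prop) hf]
  rfl

/-- If `X` and `W` are independent of laws `BH(a, b, p, q, r)` and `betaPrime (a + b - q) (r - a)`,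
then `1 / (1 + W X)` has law `BH(r - a, a + b - q, b, r + b - p - q, r + b - p)`. -/
theorem lintegral_bhMeasure_betaPrime (h : BHAdmissible a b p q r) (hc : 0 < a + b - q)
    (hd : 0 < r - a) [IsProbabilityMeasure (betaPrime (a + b - q) (r - a))] {f : ℝ → ENNReal}
    (hf : Measurable f) :
    ∫⁻ x, ∫⁻ w, f (1 / (1 + w * x)) ∂betaPrime (a + b - q) (r - a) ∂bhMeasure a b p q r
      = ∫⁻ y, f y ∂bhMeasure (r - a) (a + b - q) b (r + b - p - q) (r + b - p) := by
  have hprob := isProbabilityMeasure_bhMeasure h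
  have hZ := integral_bhFun_pos h
  obtain ⟨hr, hF, ha, hb, hrb⟩ := h
  have hr0 : 0 < r := by linarith
  have hβ := beta_pos hc hd
  have hJ := integral_bhFun_pos ⟨hr, hF, hr0, hb, hrb⟩
  set c := a + b - q with hcdef
  set d := r - a with hddef
  have hcd : r + b - q = c + d := by simp only [hcdef, hddef]; ring
  set Z := ∫ y in Ioo (0 : ℝ) 1, bhFun a b p q r y with hZdef
  set J := ∫ y in Ioo (0 : ℝ) 1, bhFun r b p q r y with hJdef
  set K := J / (Z * beta c d) with hKdef
  have hK : 0 < K := by positivity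
  have hm : Measurable fun z : ℝ × ℝ => stepDensity c d z.1 z.2 := measurable_stepDensity c d
  have hmb : Measurable (bhFun a b p q r) := measurable_bhFun a b p q r
  set g : ℝ → ℝ := bhFun d c b (r + b - p - q) (r + b - p) with hg
  have hmg : Measurable g := measurable_bhFun _ _ _ _ _
  have hgpos : ∀ y ∈ Ioo (0 : ℝ) 1, 0 < g y := by
    intro y hy
    have hyabs := abs_lt_one_of_mem_Ioo hy
    obtain ⟨hp, -, -⟩ := integral_bhFun_mul_rpow hr0 hb hrb (by linarith) hF hy
    refine bhFun_pos hy ?_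
    have hs := hasSum_ordinaryHypergeometric (p := b) (q := r + b - p - q)
      (ne_neg_natCast_of_pos hp) hyabs
    have hterm : ∀ n : ℕ, 0 < hgCoeff b (r + b - p - q) (r + b - p) n * y ^ n := fun n =>
      mul_pos (hgCoeff_pos hb hrb hp n) (pow_pos hy.1 n)
    exact hs.summable.hasSum.unique hs ▸ hs.summable.tsum_pos (fun n => (hterm n).le) 0 (hterm 0)
  have hinner : ∀ y ∈ Ioo (0 : ℝ) 1,
      ∫⁻ x in Ioo (0 : ℝ) 1, ENNReal.ofReal (bhFun a b p q r x / Z)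
        * ENNReal.ofReal (stepDensity c d x y) = ENNReal.ofReal (K * g y) := by
    intro y hy
    have hy1 : 0 < 1 - y := sub_pos.2 hy.2
    obtain ⟨-, hint, hval⟩ := integral_bhFun_mul_rpow hr0 hb hrb (by linarith) hF hy
    rw [hcd] at hint hval
    -- The factor x^d of the transition density, with d = r - a, replaces the exponent a - 1 by r -
    -- 1, as needed for `integral_bhFun_mul_rpow`.
    have e : EqOn (fun x => ENNReal.ofReal (bhFun a b p q r x / Z)
        * ENNReal.ofReal (stepDensity c d x y))
        (fun x => ENNReal.ofReal ((1 - y) ^ (c - 1) * y ^ (d - 1) / (Z * beta c d)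
          * (bhFun r b p q r x * (1 - y * (1 - x)) ^ (-(c + d))))) (Ioo 0 1) := by
      intro x hx
      have h1 := bhFun_pos (a := a) (b := b) hx (hF x hx)
      simp only
      rw [← ENNReal.ofReal_mul (by positivity)]
      congr 1
      simp only [bhFun, stepDensity]
      rw [show r - 1 = a - 1 + d by simp only [hddef]; ring, Real.rpow_add hx.1]
      field_simp
    rw [setLIntegral_congr_fun measurableSet_Ioo e,
      ← ofReal_integral_eq_lintegral_ofReal (hint.const_mul _), integral_const_mul, hval, ← hJdef]
    · congr 1
      simp only [hKdef, hg, bhFun]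
      field_simp
    · filter_upwards [ae_restrict_mem measurableSet_Ioo] with x hx
      have h1 := bhFun_pos (a := r) (b := b) hx (hF x hx)
      have h2 := one_sub_mul_one_sub_pos hx.1 hy
      have h3 : 0 < y := hy.1
      simp only [Pi.zero_apply]
      positivity
  have key : ∀ {f : ℝ → ENNReal}, Measurable f →
      ∫⁻ x, ∫⁻ w, f (1 / (1 + w * x)) ∂betaPrime c d ∂bhMeasure a b p q r
        = ∫⁻ y in Ioo (0 : ℝ) 1, ENNReal.ofReal (K * g y) * f y := by
    intro f hf
    have : SFinite (betaPrime c d) := inferInstance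
    rw [lintegral_bhMeasure (Measurable.lintegral_prod_right' (f := fun z : ℝ × ℝ =>
      f (1 / (1 + z.2 * z.1))) (by fun_prop))]
    have e1 : EqOn (fun x => ENNReal.ofReal (bhFun a b p q r x / Z)
          * ∫⁻ w, f (1 / (1 + w * x)) ∂betaPrime c d)
        (fun x => ∫⁻ y in Ioo (0 : ℝ) 1, ENNReal.ofReal (bhFun a b p q r x / Z)
          * (ENNReal.ofReal (stepDensity c d x y) * f y)) (Ioo 0 1) := by
      intro x hx
      simp only
      rw [lintegral_betaPrime_comp hx.1 hf, lintegral_const_mul']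
      exact ENNReal.ofReal_ne_top
    rw [setLIntegral_congr_fun measurableSet_Ioo e1, lintegral_lintegral_swap]
    · refine setLIntegral_congr_fun measurableSet_Ioo fun y hy => ?_
      rw [← hinner y hy, ← lintegral_mul_const _ (by fun_prop)]
      simp only [mul_assoc]
    · refine Measurable.aemeasurable ?_
      simp only [Function.uncurry_def]
      fun_prop
  -- Testing against 1 shows that K is the normalising constant of g, so no Gamma factors have to be
  -- evaluated.
  have hone := key (f := fun _ => 1) measurable_const
  simp only [lintegral_const, measure_univ, mul_one] at hone
  have hKg : K * ∫ y in Ioo (0 : ℝ) 1, g y = 1 := by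
    rw [← integral_const_mul, integral_eq_lintegral_of_nonneg_ae, ← hone, ENNReal.toReal_one]
    · filter_upwards [ae_restrict_mem measurableSet_Ioo] with y hy
      exact (mul_pos hK (hgpos y hy)).le
    · exact (hmg.const_mul K).aestronglyMeasurable
  rw [key hf, lintegral_bhMeasure hf]
  refine setLIntegral_congr_fun measurableSet_Ioo fun y _ => ?_
  congr 2
  rw [eq_div_iff]
  · rw [mul_right_comm, hKg, one_mul]
  · exact right_ne_zero_of_mul_eq_one hKg

end OneStep

/-! ### Uniqueness of stationary distributions. -/

section Uniqueness

open scoped ENNReal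

variable {S : Type*} [MeasurableSpace S]

theorem exists_add_eq_of_le {μ ν : Measure S} [IsFiniteMeasure ν] (h : ν ≤ μ) :
    ∃ α : Measure S, ν + α = μ :=
  ⟨μ - ν, by rw [add_comm, Measure.sub_add_cancel_of_le h]⟩

/-- If of any two complementary events one is charged by all the transition probabilities of a
Markov kernel, then the kernel has at most one stationary distribution. -/
theorem IsStationaryDistribution.unique {κ : Kernel S S} [IsMarkovKernel κ]
    (hκ : ∀ B : Set S, MeasurableSet B → (∀ x, κ x B ≠ 0) ∨ ∀ x, κ x Bᶜ ≠ 0) {μ ν : Measure S}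
    (hμ : IsStationaryDistribution κ μ) (hν : IsStationaryDistribution κ ν) : μ = ν := by
  obtain ⟨hμ1, hμ⟩ := hμ
  obtain ⟨hν1, hν⟩ := hν
  obtain ⟨s, hs, hs1, hs2⟩ := hahn_decomposition μ ν
  have le1 : ν.restrict s ≤ μ.restrict s := Measure.le_iff.2 fun t ht => by
    rw [Measure.restrict_apply ht, Measure.restrict_apply ht]
    exact hs1 _ (ht.inter hs) inter_subset_right
  have le2 : μ.restrict sᶜ ≤ ν.restrict sᶜ := Measure.le_iff.2 fun t ht => by
    rw [Measure.restrict_apply ht, Measure.restrict_apply ht]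
    exact hs2 _ (ht.inter hs.compl) inter_subset_right
  obtain ⟨α, hα⟩ := exists_add_eq_of_le le1
  obtain ⟨β, hβ⟩ := exists_add_eq_of_le le2
  -- ρ is the minimum of μ and ν; α and β are the positive and negative parts of μ - ν, carried by s
  -- and its complement and of equal mass.
  set ρ := ν.restrict s + μ.restrict sᶜ with hρ
  have hμρ : μ = ρ + α := by
    rw [← Measure.restrict_add_restrict_compl (μ := μ) hs, ← hα, hρ]
    abel
  have hνρ : ν = ρ + β := by
    rw [← Measure.restrict_add_restrict_compl (μ := ν) hs, ← hβ, hρ]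
    abel
  have hαs : α sᶜ = 0 := by
    have := congrArg (fun m => m sᶜ) hα
    simp only [Measure.add_apply, Measure.restrict_apply hs.compl, compl_inter_self,
      measure_empty] at this
    exact (add_eq_zero.1 this).2
  have hβs : β s = 0 := by
    have := congrArg (fun m => m s) hβ
    simp only [Measure.add_apply, Measure.restrict_apply hs, inter_compl_self,
      measure_empty] at this
    exact (add_eq_zero.1 this).2
  have hfin : ∀ B, ρ B ≠ ∞ := fun B => measure_ne_top _ _
  have hmass : α univ = β univ := by
    have h1 := congrArg (fun m => m univ) hμρ
    have h2 := congrArg (fun m => m univ) hνρ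
    simp only [Measure.add_apply, measure_univ] at h1 h2
    exact (ENNReal.add_right_inj (hfin univ)).1 (h1.symm.trans h2)
  have bind_apply : ∀ (m : Measure S) {B : Set S}, MeasurableSet B →
      m.bind κ B = ∫⁻ x, κ x B ∂m := fun m B hB => Measure.bind_apply hB κ.aemeasurable
  have e1 : ∫⁻ x, κ x sᶜ ∂ρ + ∫⁻ x, κ x sᶜ ∂α = ρ sᶜ := by
    have := congrArg (fun m => m sᶜ) (show μ.bind κ = μ from hμ)
    simp only [bind_apply μ hs.compl] at this
    rw [hμρ] at this
    rwa [lintegral_add_measure, Measure.add_apply, hαs, add_zero] at this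
  have e2 : ∫⁻ x, κ x s ∂ρ + ∫⁻ x, κ x s ∂β = ρ s := by
    have := congrArg (fun m => m s) (show ν.bind κ = ν from hν)
    simp only [bind_apply ν hs] at this
    rw [hνρ] at this
    rwa [lintegral_add_measure, Measure.add_apply, hβs, add_zero] at this
  have e3 : ∫⁻ x, κ x s ∂ρ + ∫⁻ x, κ x sᶜ ∂ρ = ρ s + ρ sᶜ := by
    rw [← lintegral_add_left (κ.measurable_coe hs)]
    simp [measure_add_measure_compl hs]
  -- Add the two invariance relations and cancel the finite mass of ρ, which the Markov kernel
  -- preserves.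
  have e4 : ∫⁻ x, κ x s ∂β + ∫⁻ x, κ x sᶜ ∂α = 0 := by
    have : (ρ s + ρ sᶜ) + (∫⁻ x, κ x s ∂β + ∫⁻ x, κ x sᶜ ∂α) = (ρ s + ρ sᶜ) + 0 := by
      nth_rewrite 1 [← e3]
      rw [add_add_add_comm, e1, e2, add_zero]
    exact (ENNReal.add_right_inj (ENNReal.add_ne_top.2 ⟨hfin _, hfin _⟩)).1 this
  obtain ⟨e5, e6⟩ := add_eq_zero.1 e4
  have eq_zero : ∀ (m : Measure S) {B : Set S}, MeasurableSet B → (∀ x, κ x B ≠ 0) →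
      ∫⁻ x, κ x B ∂m = 0 → m univ = 0 := by
    intro m B hB h h0
    rw [lintegral_eq_zero_iff (κ.measurable_coe hB)] at h0
    rw [Measure.measure_univ_eq_zero, ← ae_eq_bot]
    exact Filter.eventually_false_iff_eq_bot.1 (h0.mono fun x hx => h x hx)
  have hβ0 : β univ = 0 := by
    rcases hκ s hs with h | h
    · exact eq_zero β hs h e5
    · rw [← hmass]
      exact eq_zero α hs.compl h e6
  have hα0 : α univ = 0 := hmass.trans hβ0
  rw [Measure.measure_univ_eq_zero] at hα0 hβ0
  rw [hμρ, hνρ, hα0, hβ0]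

end Uniqueness

/-! ### Independent blocks, transition kernels and the Markov property. -/

section Kernels

/-- The transition kernel `x ↦ law of H_w(x)`, for `w` of law `ν`. -/
noncomputable def stepKernel (ν : Measure (Ioi (0 : ℝ))) : Kernel OpenUnit OpenUnit :=
  (Kernel.const OpenUnit ν ×ₖ Kernel.id).map fun z => moebiusH z.1 z.2

theorem stepKernel_eq (ν : Measure (Ioi (0 : ℝ))) [SFinite ν] (x : OpenUnit) :
    stepKernel ν x = ν.map fun w => moebiusH w x := by
  rw [stepKernel, Kernel.map_apply _ measurable_moebiusH, Kernel.prod_apply, Kernel.const_apply,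
    Kernel.id_apply, Measure.prod_dirac, Measure.map_map measurable_moebiusH (by fun_prop)]
  rfl

instance (ν : Measure (Ioi (0 : ℝ))) [IsProbabilityMeasure ν] : IsMarkovKernel (stepKernel ν) :=
  Kernel.IsMarkovKernel.map _ measurable_moebiusH

theorem lintegral_stepKernel (ν : Measure (Ioi (0 : ℝ))) [SFinite ν] (x : OpenUnit)
    {f : OpenUnit → ENNReal} (hf : Measurable f) :
    ∫⁻ y, f y ∂stepKernel ν x = ∫⁻ w, f (moebiusH w x) ∂ν := by
  rw [stepKernel_eq, lintegral_map hf
    (show Measurable fun w => moebiusH w x from measurable_moebiusH.comp measurable_prodMk_right)]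

/-- The kernel `x ↦ law of moebiusBlock w s m x`, for independent `w j` of laws `ν j`. -/
noncomputable def blockKernel (ν : ℕ → Measure (Ioi (0 : ℝ))) (s : ℕ) :
    ℕ → Kernel OpenUnit OpenUnit
  | 0 => Kernel.id
  | m + 1 => stepKernel (ν (s + m)) ∘ₖ blockKernel ν s m

instance (ν : ℕ → Measure (Ioi (0 : ℝ))) [∀ j, IsProbabilityMeasure (ν j)] (s m : ℕ) :
    IsMarkovKernel (blockKernel ν s m) := by
  induction m with
  | zero => exact inferInstanceAs (IsMarkovKernel Kernel.id)
  | succ m ih => exact inferInstanceAs (IsMarkovKernel (stepKernel (ν (s + m)) ∘ₖ _))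

theorem blockKernel_congr {ν : ℕ → Measure (Ioi (0 : ℝ))} {s t : ℕ}
    (h : ∀ j, ν (s + j) = ν (t + j)) (m : ℕ) : blockKernel ν s m = blockKernel ν t m := by
  induction m with
  | zero => rfl
  | succ m ih => simp only [blockKernel, h, ih]

theorem moebiusBlock_congr {w w' : ℕ → Ioi (0 : ℝ)} {s m : ℕ}
    (h : ∀ j, s ≤ j → j < s + m → w j = w' j) (x : OpenUnit) :
    moebiusBlock w s m x = moebiusBlock w' s m x := by
  induction m with
  | zero => rfl
  | succ m ih =>
    simp only [moebiusBlock]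
    rw [ih fun j h1 h2 => h j h1 (by omega), h (s + m) (by omega) (by omega)]

theorem moebiusChain_congr {w w' : ℕ → Ioi (0 : ℝ)} {k n : ℕ} (h : ∀ j < n * k, w j = w' j)
    (x : OpenUnit) : moebiusChain w k x n = moebiusChain w' k x n := by
  induction n with
  | zero => rfl
  | succ n ih =>
    simp only [moebiusChain]
    rw [ih fun j hj => h j (by rw [Nat.succ_mul]; omega),
      moebiusBlock_congr fun j _ h2 => h j (by rw [Nat.succ_mul]; omega)]

/-- The sequence `w` with all terms outside `T` replaced by `1`. -/
noncomputable def maskSeq (T : Finset ℕ) (w : ℕ → Ioi (0 : ℝ)) (j : ℕ) : Ioi (0 : ℝ) :=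
  open Classical in if j ∈ T then w j else ⟨1, mem_Ioi.2 one_pos⟩

theorem maskSeq_apply {T : Finset ℕ} {j : ℕ} (hj : j ∈ T) (w : ℕ → Ioi (0 : ℝ)) :
    maskSeq T w j = w j := by
  simp only [maskSeq, hj, if_true]

variable {Ω : Type*} [MeasurableSpace Ω] {P : Measure Ω} {W : ℕ → Ω → Ioi (0 : ℝ)}

/-- Masking makes a finite subfamily into a full sequence, so functionals of whole sequences can be
applied to disjoint groups of variables and stay independent. The filler value 1 is immaterial. -/
theorem indepFun_maskSeq (hW : ∀ j, Measurable (W j)) (hindep : iIndepFun W P) {S T : Finset ℕ}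
    (hST : Disjoint S T) :
    IndepFun (fun ω => maskSeq S fun j => W j ω) (fun ω => maskSeq T fun j => W j ω) P := by
  classical
  have h := hindep.indepFun_finset S T hST hW
  have hm : ∀ T : Finset ℕ, Measurable fun (u : T → Ioi (0 : ℝ)) (j : ℕ) =>
      if hj : j ∈ T then u ⟨j, hj⟩ else (⟨1, mem_Ioi.2 one_pos⟩ : Ioi (0 : ℝ)) := by
    intro T
    refine measurable_pi_lambda _ fun j => ?_
    by_cases hj : j ∈ T
    · simp only [hj, dif_pos]
      exact measurable_pi_apply _
    · simp only [hj, dif_neg, not_false_eq_true]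
      exact measurable_const
  have e : ∀ T : Finset ℕ, (fun ω => maskSeq T fun j => W j ω)
      = (fun (u : T → Ioi (0 : ℝ)) (j : ℕ) =>
        if hj : j ∈ T then u ⟨j, hj⟩ else (⟨1, mem_Ioi.2 one_pos⟩ : Ioi (0 : ℝ))) ∘
        fun ω (i : T) => W i ω := by
    intro T
    funext ω j
    by_cases hj : j ∈ T <;> simp [maskSeq, hj]
  rw [e S, e T]
  exact h.comp (hm S) (hm T)

theorem measurable_seq (hW : ∀ j, Measurable (W j)) : Measurable fun ω j => W j ω :=
  measurable_pi_lambda _ hW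

theorem measurable_maskSeq (hW : ∀ j, Measurable (W j)) (T : Finset ℕ) :
    Measurable fun ω => maskSeq T fun j => W j ω := by
  refine measurable_pi_lambda _ fun j => ?_
  by_cases hj : j ∈ T
  · simp only [maskSeq, hj, if_true]
    exact hW j
  · simp only [maskSeq, hj, if_false]
    exact measurable_const

theorem map_moebiusBlock [IsProbabilityMeasure P] (hW : ∀ j, Measurable (W j))
    (hindep : iIndepFun W P) (s m : ℕ) (x : OpenUnit) :
    P.map (fun ω => moebiusBlock (fun j => W j ω) s m x)
      = blockKernel (fun j => P.map (W j)) s m x := by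
  have hprob : ∀ j, IsProbabilityMeasure (P.map (W j)) := fun j =>
    Measure.isProbabilityMeasure_map (hW j).aemeasurable
  have hmeas : ∀ m, Measurable fun ω => moebiusBlock (fun j => W j ω) s m x := fun m =>
    (measurable_moebiusBlock s m).comp ((measurable_seq hW).prodMk measurable_const)
  induction m with
  | zero => simp [moebiusBlock, blockKernel, Kernel.id_apply]
  | succ m ih =>
    -- The block built so far involves only indices below s + m.
    have hI : IndepFun (W (s + m)) (fun ω => moebiusBlock (fun j => W j ω) s m x) P := by
      have h := indepFun_maskSeq hW hindep (S := {s + m}) (T := Finset.range (s + m)) (by simp)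
      have h' := h.comp (φ := fun w : ℕ → Ioi (0 : ℝ) => w (s + m)) (ψ := fun w => moebiusBlock w s m x)
        (show Measurable fun w : ℕ → Ioi (0 : ℝ) => w (s + m) from measurable_pi_apply _)
        ((measurable_moebiusBlock s m).comp (measurable_id.prodMk measurable_const))
      convert! h' using 1
      · funext ω
        exact (maskSeq_apply (Finset.mem_singleton_self (s + m)) fun j => W j ω).symm
      · funext ω
        exact moebiusBlock_congr (w := fun j => W j ω)
          (fun j _ hj => (maskSeq_apply (Finset.mem_range.2 hj) fun j => W j ω).symm) x
    have hpair := (indepFun_iff_map_prod_eq_prod_map_map (hW _).aemeasurable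
      (hmeas m).aemeasurable).1 hI
    refine Measure.ext_of_lintegral _ fun f hf => ?_
    have hfH : Measurable fun z : Ioi (0 : ℝ) × OpenUnit => f (moebiusH z.1 z.2) :=
      hf.comp measurable_moebiusH
    simp only [blockKernel]
    rw [Kernel.lintegral_comp _ _ _ hf, ← ih, lintegral_map hf (hmeas (m + 1))]
    simp only [moebiusBlock, lintegral_stepKernel _ _ hf]
    rw [← lintegral_prod_symm' _ hfH, ← hpair,
      lintegral_map hfH ((hW _).prodMk (hmeas m))]

theorem chainKernel_eq_blockKernel [IsProbabilityMeasure P] (hW : ∀ j, Measurable (W j))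
    (hindep : iIndepFun W P) (k : ℕ) :
    chainKernel P W hW k = blockKernel (fun j => P.map (W j)) 0 k := by
  ext1 x
  rw [← map_moebiusBlock hW hindep]
  change P.map (fun ω => moebiusChain (fun j => W j ω) k x 1) = _
  simp only [moebiusChain, zero_mul]

theorem isMarkovChainWith_moebiusChain [IsProbabilityMeasure P] (hW : ∀ j, Measurable (W j))
    (hindep : iIndepFun W P) {k : ℕ} (hper : ∀ j, P.map (W (j + k)) = P.map (W j))
    (x : OpenUnit) :
    IsMarkovChainWith P (chainKernel P W hW k)
      (fun n ω => moebiusChain (fun j => W j ω) k x n) := by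
  have hprob : ∀ j, IsProbabilityMeasure (P.map (W j)) := fun j =>
    Measure.isProbabilityMeasure_map (hW j).aemeasurable
  have hX : ∀ n, Measurable fun ω => moebiusChain (fun j => W j ω) k x n := fun n =>
    (measurable_moebiusChain k n).comp ((measurable_seq hW).prodMk measurable_const)
  refine ⟨hX, fun n B hB => ?_⟩
  set κ := chainKernel P W hW k with hκdef
  have hκ : κ = blockKernel (fun j => P.map (W j)) 0 k := chainKernel_eq_blockKernel hW hindep k
  have hκM : IsMarkovKernel κ := by rw [hκ]; infer_instance
  -- Homogeneity: the laws repeat with period k, so the n-th block has the kernel of the first.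
  have hshift : blockKernel (fun j => P.map (W j)) (n * k) k = κ := by
    rw [hκ]
    refine blockKernel_congr (fun j => ?_) k
    rw [zero_add]
    clear hκ hκM
    induction n with
    | zero => simp
    | succ n ih => rw [Nat.succ_mul, add_right_comm, hper, ih]
  set X : ℕ → Ω → OpenUnit := fun n ω => moebiusChain (fun j => W j ω) k x n with hXdef
  set Z : Ω → Fin (n + 1) → OpenUnit := fun ω m => X m ω with hZdef
  set U : Ω → ℕ → Ioi (0 : ℝ) :=
    fun ω => maskSeq (Finset.Ico (n * k) (n * k + k)) fun j => W j ω with hUdef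
  have hZ : Measurable Z := measurable_pi_lambda _ fun m => hX m
  have hU : Measurable U := measurable_maskSeq hW _
  have hstep : ∀ ω, X (n + 1) ω = moebiusBlock (U ω) (n * k) k (Z ω (Fin.last n)) := by
    intro ω
    change moebiusBlock (fun j => W j ω) (n * k) k (X n ω) = _
    exact moebiusBlock_congr (w := fun j => W j ω)
      (fun j h1 h2 => (maskSeq_apply (Finset.mem_Ico.2 ⟨h1, h2⟩) fun j => W j ω).symm) _
  have hlast : Measurable fun z : Fin (n + 1) → OpenUnit => z (Fin.last n) := by fun_prop
  -- The past up to time n uses indices below n * k, and the next step those from n * k to n * k + k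
  -- - 1.
  have hI : IndepFun Z U P := by
    have h := indepFun_maskSeq hW hindep (S := Finset.range (n * k))
      (T := Finset.Ico (n * k) (n * k + k)) (by
        rw [Finset.disjoint_left]
        intro j h1 h2
        rw [Finset.mem_range] at h1
        rw [Finset.mem_Ico] at h2
        omega)
    have h' := h.comp (φ := fun w (m : Fin (n + 1)) => moebiusChain w k x m) (ψ := id)
      (measurable_pi_lambda _ fun m => (measurable_moebiusChain k m).comp
        (measurable_id.prodMk measurable_const)) measurable_id
    convert! h' using 1
    funext ω m
    refine moebiusChain_congr (w := fun j => W j ω) (fun j hj =>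
      (maskSeq_apply (Finset.mem_range.2 ?_) fun j => W j ω).symm) x
    exact hj.trans_le (Nat.mul_le_mul_right k (Nat.lt_succ_iff.1 m.2))
  have hpair := (indepFun_iff_map_prod_eq_prod_map_map hZ.aemeasurable hU.aemeasurable).1 hI
  have hlawU : ∀ y, P.map U ((fun u => moebiusBlock u (n * k) k y) ⁻¹' B) = κ y B := by
    intro y
    have hy : Measurable fun u : ℕ → Ioi (0 : ℝ) => moebiusBlock u (n * k) k y :=
      (measurable_moebiusBlock _ _).comp (measurable_id.prodMk measurable_const)
    rw [← hshift, ← map_moebiusBlock hW hindep, Measure.map_apply hU (hy hB),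
      Measure.map_apply (f := fun ω => moebiusBlock (fun j => W j ω) (n * k) k y)
        (hy.comp (measurable_seq hW)) hB]
    congr 1
    ext ω
    simp only [mem_preimage, hUdef]
    rw [moebiusBlock_congr
      (fun j h1 h2 => maskSeq_apply (Finset.mem_Ico.2 ⟨h1, h2⟩) _)]
  have hcomap : (⨆ m : Fin (n + 1), MeasurableSpace.comap (X m) inferInstance)
      = MeasurableSpace.comap Z MeasurableSpace.pi := by
    rw [MeasurableSpace.pi, MeasurableSpace.comap_iSup]
    simp only [MeasurableSpace.comap_comp]
    rfl
  have hm := hZ.comap_le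
  have hκn : Measurable fun ω => κ (X n ω) B := (κ.measurable_coe hB).comp (hX n)
  rw [hcomap]
  refine (ae_eq_condExp_of_forall_setIntegral_eq hm ?_ ?_ ?_ ?_).symm
  · exact (integrable_const 1).indicator (hX (n + 1) hB)
  · intro s _ _
    refine Integrable.integrableOn (Integrable.of_bound (C := 1)
      hκn.ennreal_toReal.aestronglyMeasurable (Filter.Eventually.of_forall fun ω => ?_))
    rw [Real.norm_of_nonneg measureReal_nonneg]
    exact measureReal_le_one
  · rintro _ ⟨C, hC, rfl⟩ _
    -- By independence (Z, U) has a product law. Freezing the past and integrating over U gives the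
    -- kernel.
    have key : ∫⁻ ω in Z ⁻¹' C, κ (X n ω) B ∂P = P (X (n + 1) ⁻¹' B ∩ Z ⁻¹' C) := by
      set D : Set ((Fin (n + 1) → OpenUnit) × (ℕ → Ioi (0 : ℝ))) :=
        Prod.fst ⁻¹' C ∩ (fun z => moebiusBlock z.2 (n * k) k (z.1 (Fin.last n))) ⁻¹' B with hDdef
      have hD : MeasurableSet D := (measurable_fst hC).inter (((measurable_moebiusBlock (n * k)
        k).comp (measurable_snd.prodMk (hlast.comp measurable_fst))) hB)
      have e1 : X (n + 1) ⁻¹' B ∩ Z ⁻¹' C = (fun ω => (Z ω, U ω)) ⁻¹' D := by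
        ext ω
        simp only [hDdef, mem_inter_iff, mem_preimage, hstep]
        exact and_comm
      have hUp : IsProbabilityMeasure (P.map U) :=
        Measure.isProbabilityMeasure_map hU.aemeasurable
      have hmap : ∫⁻ ω in Z ⁻¹' C, κ (X n ω) B ∂P
          = ∫⁻ z in C, κ (z (Fin.last n)) B ∂P.map Z :=
        (setLIntegral_map hC ((κ.measurable_coe hB).comp hlast) hZ).symm
      rw [e1, ← Measure.map_apply (hZ.prodMk hU) hD, hpair, Measure.prod_apply hD, hmap,
        ← lintegral_indicator hC]
      refine lintegral_congr fun z => ?_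
      by_cases hz : z ∈ C
      · rw [indicator_of_mem hz, ← hlawU]
        congr 1
        ext u
        simp [hDdef, hz]
      · rw [indicator_of_notMem hz]
        have : Prod.mk z ⁻¹' D = ∅ := by
          ext u
          simp [hDdef, hz]
        rw [this, measure_empty]
    rw [setIntegral_indicator (hX (n + 1) hB), inter_comm, setIntegral_const, smul_eq_mul, mul_one]
    simp only [Measure.real]
    rw [integral_toReal hκn.aemeasurable (Filter.Eventually.of_forall fun ω => measure_lt_top _ _),
      key]
  · refine StronglyMeasurable.aestronglyMeasurable (Measurable.stronglyMeasurable ?_)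
    have : Measurable fun z : Fin (n + 1) → OpenUnit => (κ (z (Fin.last n))).real B :=
      ((κ.measurable_coe hB).comp hlast).ennreal_toReal
    exact this.comp (comap_measurable Z)

end Kernels

/-! ### Transport of laws along arrows, and positivity of the kernels. -/

section Arrows

/-- The one-step identity in symmetric coordinates. The representative (θ₅, θ₄, θ₁, θ₂, θ₃) is the
one whose traditional parameters are literally those of the image law. -/
theorem Theta.lintegral_bh_betaPrime {t : Theta} (h : t.BHExists) (hc : 0 < t.θ₁ + t.θ₅)
    (hd : 0 < t.θ₂ + t.θ₃) [IsProbabilityMeasure (betaPrime (t.θ₁ + t.θ₅) (t.θ₂ + t.θ₃))]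
    {f : ℝ → ENNReal} (hf : Measurable f) :
    ∫⁻ x, ∫⁻ w, f (1 / (1 + w * x)) ∂betaPrime (t.θ₁ + t.θ₅) (t.θ₂ + t.θ₃) ∂t.bh
      = ∫⁻ y, f y ∂(Theta.mk t.θ₅ t.θ₄ t.θ₁ t.θ₂ t.θ₃).bh := by
  have ec : t.a + t.b - t.q = t.θ₁ + t.θ₅ := by simp only [a, b, q]; ring
  have ed : t.r - t.a = t.θ₂ + t.θ₃ := by simp only [a, r]; ring
  have : IsProbabilityMeasure (betaPrime (t.a + t.b - t.q) (t.r - t.a)) := by rwa [ec, ed]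
  have key := lintegral_bhMeasure_betaPrime h (by rwa [ec]) (by rwa [ed]) hf
  have ea' : (Theta.mk t.θ₅ t.θ₄ t.θ₁ t.θ₂ t.θ₃).a = t.θ₂ + t.θ₃ := rfl
  have eb' : (Theta.mk t.θ₅ t.θ₄ t.θ₁ t.θ₂ t.θ₃).b = t.θ₁ + t.θ₅ := add_comm _ _
  have ep' : (Theta.mk t.θ₅ t.θ₄ t.θ₁ t.θ₂ t.θ₃).p = t.b := rfl
  have eq' : (Theta.mk t.θ₅ t.θ₄ t.θ₁ t.θ₂ t.θ₃).q = t.r + t.b - t.p - t.q := by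
    simp only [b, p, q, r]; ring
  have er' : (Theta.mk t.θ₅ t.θ₄ t.θ₁ t.θ₂ t.θ₃).r = t.r + t.b - t.p := by
    simp only [b, p, r]; ring
  rw [ec, ed] at key
  rw [bh, bh, ea', eb', ep', eq', er', key]

theorem lintegral_bh_arrowLaw {t t' : Theta} (h : t.BHExists) (h' : t'.BHExists)
    (harrow : BHArrow t.vertex t'.vertex) (hc : 0 < arrowParam₁ t.vertex t'.vertex)
    (hd : 0 < arrowParam₂ t.vertex) [hprob : IsProbabilityMeasure (arrowLaw t.vertex t'.vertex)]
    {f : ℝ → ENNReal} (hf : Measurable f) :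
    ∫⁻ x, ∫⁻ w, f (1 / (1 + w * x)) ∂arrowLaw t.vertex t'.vertex ∂t.bh = ∫⁻ y, f y ∂t'.bh := by
  have aux : ∀ u u' : Theta, u.vertex = t.vertex → u'.vertex = t'.vertex →
      u' = ⟨u.θ₅, u.θ₄, u.θ₁, u.θ₂, u.θ₃⟩ →
      ∫⁻ x, ∫⁻ w, f (1 / (1 + w * x)) ∂arrowLaw t.vertex t'.vertex ∂t.bh
        = ∫⁻ y, f y ∂t'.bh := by
    rintro u u' hu hu' rfl
    obtain ⟨hex, hbh⟩ := h.of_vertex_eq hu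
    rw [← (h'.of_vertex_eq hu').2, ← hbh]
    rw [← hu, ← hu'] at hc hprob ⊢
    rw [← hu] at hd
    have : IsProbabilityMeasure (betaPrime (u.θ₁ + u.θ₅) (u.θ₂ + u.θ₃)) := hprob
    exact Theta.lintegral_bh_betaPrime hex hc hd hf
  have cases_arrow : ∀ v v', BHArrow v v' → t.vertex = v → t'.vertex = v' → ∃ u u' : Theta,
      u.vertex = t.vertex ∧ u'.vertex = t'.vertex ∧ u' = ⟨u.θ₅, u.θ₄, u.θ₁, u.θ₂, u.θ₃⟩ := by
    intro v v' harrow hv hv'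
    cases harrow with
    | fst u =>
      refine ⟨u, _, hv.symm, ?_, rfl⟩
      rw [hv']
      simp only [Theta.vertex, Sym2.eq_swap (a := u.θ₄) (b := u.θ₁)]
    | snd u =>
      -- The second kind of arrow is the first kind after exchanging θ₄ and θ₅ in the source.
      refine ⟨u.swapFourFive, _, ?_, ?_, rfl⟩
      · rw [hv]
        simp only [Theta.vertex, Theta.swapFourFive, Sym2.eq_swap (a := u.θ₅) (b := u.θ₄)]
      · rw [hv']
        simp only [Theta.vertex, Theta.swapFourFive, Sym2.eq_swap (a := u.θ₅) (b := u.θ₁)]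
  obtain ⟨u, u', h1, h2, h3⟩ := cases_arrow _ _ harrow rfl rfl
  exact aux u u' h1 h2 h3

theorem measurableEmbedding_openUnit : MeasurableEmbedding (Subtype.val : OpenUnit → ℝ) :=
  MeasurableEmbedding.subtype_coe measurableSet_Ioo

/-- The distribution `BH_t`, as a measure on `OpenUnit`. -/
noncomputable def Theta.bhOpenUnit (t : Theta) : Measure OpenUnit := t.bh.comap Subtype.val

theorem Theta.map_bhOpenUnit (t : Theta) : t.bhOpenUnit.map Subtype.val = t.bh := by
  rw [bhOpenUnit, measurableEmbedding_openUnit.map_comap, Subtype.range_coe]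
  refine Measure.restrict_eq_self_of_ae_mem ?_
  have : t.bh ≪ volume.restrict (Ioo (0 : ℝ) 1) := withDensity_absolutelyContinuous _ _
  exact this.ae_le (ae_restrict_mem measurableSet_Ioo)

theorem Theta.eq_bhOpenUnit {t : Theta} {μ : Measure OpenUnit} (h : μ.map Subtype.val = t.bh) :
    μ = t.bhOpenUnit := by
  rw [bhOpenUnit, ← h, measurableEmbedding_openUnit.comap_map]

theorem Theta.isProbabilityMeasure_bhOpenUnit {t : Theta} (h : t.BHExists) :
    IsProbabilityMeasure t.bhOpenUnit := by
  have h1 : IsProbabilityMeasure t.bh := isProbabilityMeasure_bhMeasure h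
  rw [← t.map_bhOpenUnit] at h1
  exact (Measure.isProbabilityMeasure_map_iff measurable_subtype_coe.aemeasurable).1 h1

theorem bind_stepKernel {t t' : Theta} (h : t.BHExists) (h' : t'.BHExists)
    (harrow : BHArrow t.vertex t'.vertex) (hc : 0 < arrowParam₁ t.vertex t'.vertex)
    (hd : 0 < arrowParam₂ t.vertex) {ν : Measure (Ioi (0 : ℝ))} [IsProbabilityMeasure ν]
    (hν : ν.map Subtype.val = arrowLaw t.vertex t'.vertex) :
    t.bhOpenUnit.bind (stepKernel ν) = t'.bhOpenUnit := by
  have hprob : IsProbabilityMeasure (arrowLaw t.vertex t'.vertex) :=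
    hν ▸ Measure.isProbabilityMeasure_map measurable_subtype_coe.aemeasurable
  refine Theta.eq_bhOpenUnit (Measure.ext_of_lintegral _ fun f hf => ?_)
  rw [← lintegral_bh_arrowLaw h h' harrow hc hd hf, lintegral_map hf measurable_subtype_coe,
    Measure.lintegral_bind (f := fun x : OpenUnit => f x) (Kernel.aemeasurable _)
      (hf.comp measurable_subtype_coe).aemeasurable, ← t.map_bhOpenUnit,
    lintegral_map (Measurable.lintegral_prod_right' (f := fun z : ℝ × ℝ =>
      f (1 / (1 + z.2 * z.1))) (by fun_prop)) measurable_subtype_coe]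
  refine lintegral_congr fun x => ?_
  rw [lintegral_stepKernel _ _ (f := fun x : OpenUnit => f x) (hf.comp measurable_subtype_coe),
    ← hν,
    lintegral_map (by fun_prop) measurable_subtype_coe]
  rfl

/-- From any x, the image has density `stepDensity c d x`, which is strictly positive on all of (0,
1). -/
theorem stepKernel_apply_ne_zero {c d : ℝ} (hc : 0 < c) (hd : 0 < d) {ν : Measure (Ioi (0 : ℝ))}
    [SFinite ν] (hν : ν.map Subtype.val = betaPrime c d) {B : Set OpenUnit}
    (hB : MeasurableSet B) (hvol : volume (Subtype.val '' B) ≠ 0) (x : OpenUnit) :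
    stepKernel ν x B ≠ 0 := by
  set A : Set ℝ := Subtype.val '' B with hAdef
  have hA : MeasurableSet A := measurableEmbedding_openUnit.measurableSet_image.2 hB
  have hf : Measurable (A.indicator (1 : ℝ → ENNReal)) := measurable_one.indicator hA
  have e : stepKernel ν x B = ∫⁻ y in Ioo (0 : ℝ) 1,
      ENNReal.ofReal (stepDensity c d x y) * A.indicator 1 y := by
    rw [← lintegral_betaPrime_comp x.2.1 hf, ← hν,
      lintegral_map (f := fun w : ℝ => A.indicator 1 (1 / (1 + w * x)))
        (hf.comp (by fun_prop : Measurable fun w : ℝ => 1 / (1 + w * x)))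
        measurable_subtype_coe,
      ← lintegral_indicator_one hB, lintegral_stepKernel _ _ (measurable_one.indicator hB)]
    refine lintegral_congr fun w => ?_
    change B.indicator 1 (moebiusH w x) = A.indicator 1 ((moebiusH w x : OpenUnit) : ℝ)
    have : ((moebiusH w x : OpenUnit) : ℝ) ∈ A ↔ moebiusH w x ∈ B :=
      Subtype.val_injective.mem_set_image
    by_cases hm : moebiusH w x ∈ B
    · rw [indicator_of_mem hm, indicator_of_mem (this.2 hm)]
      rfl
    · rw [indicator_of_notMem hm, indicator_of_notMem (mt this.1 hm)]
  rw [e]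
  intro h0
  have hm := measurable_stepDensity c d
  have hmx : Measurable fun y => stepDensity c d x y := hm.comp measurable_prodMk_left
  have hprod : Measurable fun y => ENNReal.ofReal (stepDensity c d x y) * A.indicator 1 y :=
    hmx.ennreal_ofReal.mul hf
  rw [lintegral_eq_zero_iff hprod, Filter.EventuallyEq,
    ae_restrict_iff' measurableSet_Ioo] at h0
  refine hvol (measure_mono_null (fun y hy => ?_) h0)
  have hy' : y ∈ Ioo (0 : ℝ) 1 := by
    obtain ⟨z, -, rfl⟩ := hy
    exact z.2
  intro hcon
  have := hcon hy'
  simp only [indicator_of_mem hy, Pi.one_apply, mul_one, Pi.zero_apply,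
    ENNReal.ofReal_eq_zero] at this
  exact this.not_gt (stepDensity_pos hc hd x.2.1 hy')

theorem volume_image_ne_zero_or (B : Set OpenUnit) :
    volume (Subtype.val '' B) ≠ 0 ∨ volume (Subtype.val '' Bᶜ) ≠ 0 := by
  by_contra! h
  have h1 := measure_union_null h.1 h.2
  rw [← image_union, union_compl_self, image_univ, Subtype.range_coe, Real.volume_Ioo] at h1
  norm_num at h1

/-- Only the last map matters: a positive function has positive integral against the law reached
before it. -/
theorem blockKernel_succ_apply_ne_zero {ν : ℕ → Measure (Ioi (0 : ℝ))}
    [∀ j, IsProbabilityMeasure (ν j)] {s m : ℕ} {B : Set OpenUnit} (hB : MeasurableSet B)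
    (h : ∀ x, stepKernel (ν (s + m)) x B ≠ 0) (x : OpenUnit) :
    blockKernel ν s (m + 1) x B ≠ 0 := by
  rw [blockKernel, Kernel.comp_apply' _ _ _ hB]
  intro h0
  rw [lintegral_eq_zero_iff (Kernel.measurable_coe _ hB)] at h0
  obtain ⟨y, hy⟩ := h0.exists
  exact h y hy

end Arrows

/-! ### The chain attached to a cycle. -/

theorem theorem4p3 {Ω : Type*} [MeasurableSpace Ω] (P : Measure Ω) [IsProbabilityMeasure P]
    (θ : Theta) (k : ℕ) (v : ℕ → BHVertex) (hv : IsCycleGStarStar θ k v)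
    (W : ℕ → Ω → Ioi (0 : ℝ)) (hW : ∀ j, Measurable (W j)) (hindep : iIndepFun W P)
    (hlaw : ∀ j, P.map (fun ω => (W j ω : ℝ)) = arrowLaw (v j) (v (j + 1))) :
    (∀ x : OpenUnit, IsMarkovChainWith P (chainKernel P W hW k)
      (fun n ω => moebiusChain (fun j => W j ω) k x n)) ∧
    ∀ s : Theta, s.vertex = v 0 →
      ∃ π : Measure OpenUnit, π.map Subtype.val = s.bh ∧
        ∀ μ : Measure OpenUnit, IsStationaryDistribution (chainKernel P W hW k) μ ↔ μ = π := by
  have hprob : ∀ j, IsProbabilityMeasure (P.map (W j)) := fun j =>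
    Measure.isProbabilityMeasure_map (hW j).aemeasurable
  have hν : ∀ j, (P.map (W j)).map Subtype.val = arrowLaw (v j) (v (j + 1)) := fun j => by
    rw [Measure.map_map measurable_subtype_coe (hW j), ← hlaw j]
    rfl
  have hper : ∀ j, P.map (W (j + k)) = P.map (W j) := by
    intro j
    have hemb : MeasurableEmbedding (Subtype.val : Ioi (0 : ℝ) → ℝ) :=
      MeasurableEmbedding.subtype_coe measurableSet_Ioi
    rw [← hemb.comap_map (P.map (W (j + k))), ← hemb.comap_map (P.map (W j)), hν, hν,
      show j + k + 1 = j + 1 + k by ring, hv.periodic, hv.periodic]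
  refine ⟨fun x => isMarkovChainWith_moebiusChain hW hindep hper x, fun s hs => ?_⟩
  have hκ := chainKernel_eq_blockKernel hW hindep k
  have hκM : IsMarkovKernel (chainKernel P W hW k) := by rw [hκ]; infer_instance
  choose t ht hex using fun j => (hv.edge j).2.1
  -- Following the cycle for m arrows carries the law at the initial vertex to the law at the m-th
  -- one.
  have hinv : ∀ m, (t 0).bhOpenUnit.bind (blockKernel (fun j => P.map (W j)) 0 m)
      = (t m).bhOpenUnit := by
    intro m
    induction m with
    | zero => exact Measure.id_comp
    | succ m ih =>
      obtain ⟨⟨⟨-, -, harrow⟩, hc, hd⟩, -⟩ := hv.edge m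
      rw [← ht m, ← ht (m + 1)] at harrow hc
      rw [← ht m] at hd
      have := hν m
      rw [← ht m, ← ht (m + 1)] at this
      rw [blockKernel, ← Measure.comp_assoc, ih, zero_add]
      exact bind_stepKernel (hex m) (hex (m + 1)) harrow hc hd this
  have hs0 : s.bh = (t 0).bh := ((hex 0).of_vertex_eq (hs.trans (ht 0).symm)).2
  -- The chosen representatives `t k` and `t 0` may differ, but they lie over the same vertex.
  have hk0 : (t k).bh = (t 0).bh := by
    refine ((hex 0).of_vertex_eq ?_).2
    rw [ht, ht, ← hv.periodic 0, zero_add]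
  have hstat : IsStationaryDistribution (chainKernel P W hW k) (t 0).bhOpenUnit := by
    refine ⟨Theta.isProbabilityMeasure_bhOpenUnit (hex 0), ?_⟩
    rw [Kernel.Invariant, hκ, hinv k, Theta.bhOpenUnit, hk0, ← Theta.bhOpenUnit]
  refine ⟨(t 0).bhOpenUnit, (t 0).map_bhOpenUnit.trans hs0.symm, fun μ => ⟨fun hμ => ?_, ?_⟩⟩
  -- Since k ≥ 1, each block has a last map, indexed by m = k - 1, to which the positivity argument
  -- applies.
  · obtain ⟨m, rfl⟩ := Nat.exists_eq_succ_of_ne_zero hv.pos.ne'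
    have hpos : ∀ B : Set OpenUnit, MeasurableSet B → volume (Subtype.val '' B) ≠ 0 →
        ∀ x, chainKernel P W hW (m + 1) x B ≠ 0 := by
      intro B hB hvol x
      obtain ⟨⟨-, hc, hd⟩, -⟩ := hv.edge m
      rw [hκ]
      refine blockKernel_succ_apply_ne_zero hB (fun y => ?_) x
      rw [zero_add]
      exact stepKernel_apply_ne_zero hc hd (hν m) hB hvol y
    exact hμ.unique (fun B hB => (volume_image_ne_zero_or B).imp (hpos B hB)
      (hpos Bᶜ hB.compl)) hstat
  · rintro rfl
    exact hstat
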